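/- Let $G$ be a finite group and let $n$ be an integer with $0\le n\le 15$. A partial $G$-partition of $[n]=\{1,\dots,n\}$ consists of a subset $S\subseteq[n]$, a function $f\colon S\to G$, and a partition of $S$ into unordered nonempty blocks $A_1,\dots,A_k$; two of them, $(S,f,A_\bullet)$ and $(T,h,B_\bullet)$, are equivalent if $S=T$, the set partitions agree, and for every block $A_i$ there is $g_i\in G$ with $f|_{A_i}=g_i\cdot h|_{A_i}$. Order the equivalence classes by declaring that $x\le y$ if $y$ is obtained from $x$, up to equivalence, by a sequence of operations each of which merges blocks or deletes a block. The resulting poset is the lattice of flats of a simple matroid $\mathsf{Q}_n(G)$ of rank $n$, whose elements are the atoms of the poset (the Dowling geometry). For a loopless matroid $\mathsf{M}$, the Kazhdan--Lusztig polynomial $P_{\mathsf{M}}(t)\in\mathbb{Z}[t]$ and the $Z$-polynomial $Z_{\mathsf{M}}(t)$ are the unique polynomials such that $P_{\mathsf{M}}(t)=1$ if $\operatorname{rk}\mathsf{M}=0$; $\deg P_{\mathsf{M}}(t)<\tfrac12\operatorname{rk}\mathsf{M}$ if $\operatorname{rk}\mathsf{M}>0$; and, for every $\mathsf{M}$, $$Z_{\mathsf{M}}(t)=\sum_{F}t^{\operatorname{rk}F}\,P_{\mathsf{M}/F}(t),$$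 the sum being over all flats $F$ of $\mathsf{M}$, is palindromic of degree $d=\operatorname{rk}\mathsf{M}$, that is, it has degree $d$ and $Z_{\mathsf{M}}(t)=t^{d}Z_{\mathsf{M}}(t^{-1})$. Then both polynomials $P_{\mathsf{Q}_n(G)}(t)$ and $Z_{\mathsf{Q}_n(G)}(t)$ are real-rooted, that is, all of their complex zeros are real. -/

import Mathlib

/-! ## Kazhdan–Lusztig polynomials and `Z`-polynomials of matroids -/

namespace Matroid

open Polynomial

variable {α : Type*}

/-- The rank of a matroid, as a natural number (meaningful for matroids of finite rank). -/
noncomputable def natRank (M : Matroid α) : ℕ := M.eRank.toNat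

/-- The rank of a set in a matroid, as a natural number (meaningful for sets of finite rank). -/
noncomputable def natRk (M : Matroid α) (F : Set α) : ℕ := (M.eRk F).toNat

/-- `∑_F t ^ rk F * P (M / F)`, the sum being over all flats `F` of `M`. -/
noncomputable def flatSum (P : Matroid α → ℤ[X]) (M : Matroid α) : ℤ[X] :=
  ∑ᶠ F : {F : Set α // M.IsFlat F}, X ^ M.natRk F.1 * P (M ／ F.1)

/-- The defining conditions of the Kazhdan–Lusztig polynomials of loopless matroids. A polynomial
is palindromic when it equals its `Polynomial.reverse`, that is `t ^ deg f * f (1 / t)`. -/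
structure IsKLAssignment (P : Matroid α → ℤ[X]) : Prop where
  rank_zero : ∀ M : Matroid α, M.Loopless → M.natRank = 0 → P M = 1
  degree_lt : ∀ M : Matroid α, M.Loopless → 0 < M.natRank → 2 * (P M).natDegree < M.natRank
  natDegree_flatSum : ∀ M : Matroid α, M.Loopless → (flatSum P M).natDegree = M.natRank
  palindromic : ∀ M : Matroid α, M.Loopless → (flatSum P M).reverse = flatSum P M

lemma ncard_contract_lt [Finite α] {M : Matroid α} {F : Set α} (hF : M.IsFlat F)
    (h0 : F.Nonempty) : (M ／ F).E.ncard < M.E.ncard := by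
  refine Set.ncard_lt_ncard ?_ (Set.toFinite _)
  rw [contract_ground, Set.sdiff_ssubset_left_iff]
  obtain ⟨x, hx⟩ := h0
  exact ⟨x, hF.subset_ground hx, hx⟩

/-- The Kazhdan–Lusztig polynomial of a (loopless) matroid on a finite type. If `r` is the rank and
`R` is the part of the `Z`-polynomial that comes from the nonempty flats, then the conditions
`deg P < r / 2` and `P + R` palindromic of degree `r` say precisely that the coefficients of `P`
are `R.coeff (r - i) - R.coeff i` for `2 * i < r`. See `isKLAssignment_klPoly` and
`IsKLAssignment.eq_klPoly`. -/
noncomputable def klPoly [Finite α] (M : Matroid α) : ℤ[X] :=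
  if M.natRank = 0 then 1 else
    ∑ i ∈ Finset.range M.natRank with 2 * i < M.natRank,
      C ((∑ᶠ F : {F : Set α // M.IsFlat F ∧ F.Nonempty},
            X ^ M.natRk F.1 * klPoly (M ／ F.1)).coeff (M.natRank - i) -
          (∑ᶠ F : {F : Set α // M.IsFlat F ∧ F.Nonempty},
            X ^ M.natRk F.1 * klPoly (M ／ F.1)).coeff i) * X ^ i
termination_by M.E.ncard
decreasing_by
  all_goals exact ncard_contract_lt F.2.1 F.2.2

/-- The `Z`-polynomial of a (loopless) matroid on a finite type. -/
noncomputable def zPoly [Finite α] (M : Matroid α) : ℤ[X] := flatSum klPoly M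

lemma loopless_contract {M : Matroid α} {F : Set α} (hF : M.IsFlat F) : (M ／ F).Loopless := by
  rw [loopless_iff, contract_loops_eq, hF.closure, Set.sdiff_self]

lemma natRk_add_natRank_contract [Finite α] {M : Matroid α} {F : Set α} (hF : M.IsFlat F) :
    M.natRk F + (M ／ F).natRank = M.natRank := by
  obtain ⟨I, hI⟩ := M.exists_isBasis F hF.subset_ground
  obtain ⟨B, hB, hIB⟩ := hI.indep.exists_isBase_superset
  have hBF : B ∩ F = I :=
    (hI.eq_of_subset_indep (hB.indep.inter_right F) (Set.subset_inter hIB hI.subset)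
      Set.inter_subset_right).symm
  have h1 : (M ／ F).IsBase (B \ F) := by
    have := hB.isBasis_ground.contract_isBasis hI
      (by rw [← hBF, Set.sdiff_union_inter]; exact hB.indep)
    rwa [← contract_ground, isBasis_ground_iff] at this
  rw [natRk, natRank, natRank, ← hI.encard_eq_eRk, ← h1.encard_eq_eRank, ← hB.encard_eq_eRank,
    ← hBF]
  change (B ∩ F).ncard + (B \ F).ncard = B.ncard
  exact Set.ncard_inter_add_ncard_sdiff_eq_ncard B F (Set.toFinite _)

lemma natRank_eq_zero_iff [Finite α] {M : Matroid α} (hM : M.Loopless) :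
    M.natRank = 0 ↔ M.E = ∅ := by
  constructor
  · intro h
    have h1 : M.eRank = 0 := by
      rcases (ENat.toNat_eq_zero).1 h with h | h
      · exact h
      · exact absurd h ((eRank_ne_top_iff M).2 inferInstance)
    rw [← eRk_ground, eRk_eq_zero_iff, hM.loops_eq_empty] at h1
    exact Set.subset_empty_iff.1 h1
  · intro h
    rw [natRank, ← eRk_ground, h, eRk_empty]; rfl

lemma isFlat_empty {M : Matroid α} (hM : M.Loopless) : M.IsFlat ∅ := by
  rw [isFlat_iff_closure_eq]
  exact M.loops_eq_empty

lemma flatSum_eq [Finite α] (P : Matroid α → ℤ[X]) {M : Matroid α} (hM : M.Loopless) :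
    flatSum P M = P M + ∑ᶠ F : {F : Set α // M.IsFlat F ∧ F.Nonempty},
      X ^ M.natRk F.1 * P (M ／ F.1) := by
  classical
  have h1 : flatSum P M = ∑ᶠ (F : Set α) (_ : F ∈ {F | M.IsFlat F}),
      X ^ M.natRk F * P (M ／ F) :=
    finsum_set_coe_eq_finsum_mem (f := fun F ↦ X ^ M.natRk F * P (M ／ F)) {F | M.IsFlat F}
  have h2 : ∑ᶠ F : {F : Set α // M.IsFlat F ∧ F.Nonempty}, X ^ M.natRk F.1 * P (M ／ F.1) =
      ∑ᶠ (F : Set α) (_ : F ∈ {F | M.IsFlat F ∧ F.Nonempty}), X ^ M.natRk F * P (M ／ F) :=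
    finsum_set_coe_eq_finsum_mem (f := fun F ↦ X ^ M.natRk F * P (M ／ F))
      {F | M.IsFlat F ∧ F.Nonempty}
  have h3 : {F | M.IsFlat F} = insert ∅ {F | M.IsFlat F ∧ F.Nonempty} := by
    ext F
    rcases F.eq_empty_or_nonempty with rfl | h
    · simp [isFlat_empty hM]
    · simp [h, h.ne_empty]
  rw [h1, h2, h3, finsum_mem_insert _ (by simp) (Set.toFinite _)]
  simp [natRk]

lemma klPoly_eq [Finite α] (M : Matroid α) (h : M.natRank ≠ 0) :
    M.klPoly = ∑ i ∈ Finset.range M.natRank with 2 * i < M.natRank,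
      C ((∑ᶠ F : {F : Set α // M.IsFlat F ∧ F.Nonempty},
            X ^ M.natRk F.1 * klPoly (M ／ F.1)).coeff (M.natRank - i) -
          (∑ᶠ F : {F : Set α // M.IsFlat F ∧ F.Nonempty},
            X ^ M.natRk F.1 * klPoly (M ／ F.1)).coeff i) * X ^ i := by
  rw [klPoly, if_neg h]

lemma coeff_klPoly [Finite α] (M : Matroid α) (h : M.natRank ≠ 0) (i : ℕ) :
    M.klPoly.coeff i = if 2 * i < M.natRank then
        (∑ᶠ F : {F : Set α // M.IsFlat F ∧ F.Nonempty},
            X ^ M.natRk F.1 * klPoly (M ／ F.1)).coeff (M.natRank - i) -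
          (∑ᶠ F : {F : Set α // M.IsFlat F ∧ F.Nonempty},
            X ^ M.natRk F.1 * klPoly (M ／ F.1)).coeff i else 0 := by
  rw [klPoly_eq M h, finsetSum_coeff]
  simp only [coeff_C_mul_X_pow]
  rw [Finset.sum_ite_eq]
  refine if_congr ?_ rfl rfl
  simp only [Finset.mem_filter, Finset.mem_range]
  omega

lemma klPoly_of_natRank_eq_zero [Finite α] (M : Matroid α) (h : M.natRank = 0) :
    M.klPoly = 1 := by
  rw [klPoly, if_pos h]

lemma natDegree_klPoly [Finite α] (M : Matroid α) (h : 0 < M.natRank) :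
    2 * M.klPoly.natDegree < M.natRank := by
  by_cases h0 : M.klPoly = 0
  · simpa [h0] using h
  by_contra hc
  have := coeff_klPoly M h.ne' M.klPoly.natDegree
  rw [if_neg hc, coeff_natDegree, leadingCoeff_eq_zero] at this
  exact h0 this

lemma coeff_term [Finite α] {P : Matroid α → ℤ[X]}
    (h0 : ∀ M : Matroid α, M.Loopless → M.natRank = 0 → P M = 1)
    (h1 : ∀ M : Matroid α, M.Loopless → 0 < M.natRank → 2 * (P M).natDegree < M.natRank)
    {M : Matroid α} {F : Set α} (hF : M.IsFlat F) (i : ℕ) (hi : M.natRank ≤ i) :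
    (X ^ M.natRk F * P (M ／ F)).coeff i = if F = M.E ∧ i = M.natRank then 1 else 0 := by
  have hl := loopless_contract hF
  have hr := natRk_add_natRank_contract hF
  have hE : (M ／ F).natRank = 0 ↔ F = M.E := by
    rw [natRank_eq_zero_iff hl, contract_ground, Set.sdiff_eq_empty]
    exact ⟨fun h ↦ hF.subset_ground.antisymm h, fun h ↦ h ▸ subset_rfl⟩
  rw [coeff_X_pow_mul']
  by_cases h : F = M.E
  · rw [h0 _ hl (hE.2 h), coeff_one]
    have := hE.2 h
    simp only [h, true_and]
    subst h
    split_ifs <;> omega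
  · have h2 := h1 _ hl (Nat.pos_of_ne_zero (fun h' ↦ h (hE.1 h')))
    rw [coeff_eq_zero_of_natDegree_lt (by omega)]
    simp [h]

lemma coeff_flatSum [Finite α] {P : Matroid α → ℤ[X]}
    (h0 : ∀ M : Matroid α, M.Loopless → M.natRank = 0 → P M = 1)
    (h1 : ∀ M : Matroid α, M.Loopless → 0 < M.natRank → 2 * (P M).natDegree < M.natRank)
    (M : Matroid α) (i : ℕ) (hi : M.natRank ≤ i) :
    (flatSum P M).coeff i = if i = M.natRank then 1 else 0 := by
  classical
  have := Fintype.ofFinite {F : Set α // M.IsFlat F}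
  rw [flatSum, finsum_eq_sum_of_fintype, finsetSum_coeff,
    Finset.sum_congr rfl fun F _ ↦ coeff_term h0 h1 F.2 i hi]
  rw [Finset.sum_eq_single (⟨M.E, M.ground_isFlat⟩ : {F : Set α // M.IsFlat F})]
  · simp
  · intro F _ hF
    rw [if_neg]
    exact fun h ↦ hF (Subtype.ext h.1)
  · simp

/-- The polynomials `klPoly` satisfy the defining conditions. -/
theorem isKLAssignment_klPoly [Finite α] : IsKLAssignment (klPoly (α := α)) := by
  have h0 : ∀ M : Matroid α, M.Loopless → M.natRank = 0 → M.klPoly = 1 :=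
    fun M _ h ↦ klPoly_of_natRank_eq_zero M h
  have h1 : ∀ M : Matroid α, M.Loopless → 0 < M.natRank →
    2 * M.klPoly.natDegree < M.natRank := fun M _ h ↦ natDegree_klPoly M h
  have h2 : ∀ M : Matroid α, M.Loopless → (flatSum klPoly M).natDegree = M.natRank := by
    intro M _
    refine natDegree_eq_of_le_of_coeff_ne_zero ?_ ?_
    · rw [natDegree_le_iff_coeff_eq_zero]
      intro i hi
      rw [coeff_flatSum h0 h1 M i hi.le, if_neg hi.ne']
    · rw [coeff_flatSum h0 h1 M _ le_rfl, if_pos rfl]; exact one_ne_zero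
  refine ⟨h0, h1, h2, fun M hM ↦ ?_⟩
  ext i
  rw [coeff_reverse, h2 M hM]
  rcases lt_or_ge M.natRank i with hi | hi
  · rw [revAt_eq_self_of_lt hi]
  rw [revAt_le hi]
  rcases Nat.eq_zero_or_pos M.natRank with hr | hr
  · congr 1; omega
  have key : ∀ j, 2 * j < M.natRank →
      (flatSum klPoly M).coeff (M.natRank - j) = (flatSum klPoly M).coeff j := by
    intro j hj
    rw [flatSum_eq _ hM, coeff_add, coeff_add, coeff_klPoly M hr.ne', coeff_klPoly M hr.ne',
      if_neg (by omega), if_pos hj]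
    ring
  rcases lt_trichotomy (2 * i) M.natRank with h | h | h
  · exact key i h
  · congr 1; omega
  · have := key (M.natRank - i) (by omega)
    rw [← this]; congr 1; omega

/-- The defining conditions determine the Kazhdan–Lusztig polynomials. -/
theorem IsKLAssignment.eq_klPoly [Finite α] {P : Matroid α → ℤ[X]} (hP : IsKLAssignment P)
    (M : Matroid α) (hM : M.Loopless) : P M = M.klPoly := by
  induction h : M.E.ncard using Nat.strong_induction_on generalizing M with
  | _ k ih =>
  subst h
  rcases Nat.eq_zero_or_pos M.natRank with hr | hr
  · rw [hP.rank_zero M hM hr, klPoly_of_natRank_eq_zero M hr]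
  have hR : ∑ᶠ F : {F : Set α // M.IsFlat F ∧ F.Nonempty}, X ^ M.natRk F.1 * P (M ／ F.1) =
      ∑ᶠ F : {F : Set α // M.IsFlat F ∧ F.Nonempty}, X ^ M.natRk F.1 * klPoly (M ／ F.1) := by
    refine finsum_congr fun F ↦ ?_
    rw [ih _ (ncard_contract_lt F.2.1 F.2.2) _ (loopless_contract F.2.1) rfl]
  ext i
  rw [coeff_klPoly M hr.ne']
  have hd := hP.degree_lt M hM hr
  split_ifs with hi
  · have h1 := congrArg (fun p ↦ p.coeff i) (hP.palindromic M hM)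
    simp only [coeff_reverse, hP.natDegree_flatSum M hM] at h1
    rw [revAt_le (by omega), flatSum_eq _ hM, hR, coeff_add, coeff_add,
      coeff_eq_zero_of_natDegree_lt (p := P M) (n := M.natRank - i) (by omega)] at h1
    linarith
  · exact coeff_eq_zero_of_natDegree_lt (by omega)

end Matroid

/-! ## Dowling geometries -/

/-- A partial `G`-partition of `[n]`: a subset of `[n]`, a `G`-valued function on it, and a partition
of it into unordered nonempty blocks (the classes of an equivalence relation). -/
structure PartialGPartition (n : ℕ) (G : Type*) where
  /-- The underlying subset of `[n]`. -/
  carrier : Set (Fin n)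
  /-- The `G`-valued function on the subset. -/
  label : carrier → G
  /-- The partition of the subset, given by the relation of lying in the same block. -/
  blocks : Setoid carrier

namespace PartialGPartition

variable {n : ℕ} {G : Type*}

/-- `i` and `j` lie in the subset and in the same block. -/
def Rel (p : PartialGPartition n G) (i j : Fin n) : Prop :=
  ∃ (hi : i ∈ p.carrier) (hj : j ∈ p.carrier), p.blocks ⟨i, hi⟩ ⟨j, hj⟩

/-- Two partial `G`-partitions are equivalent if they have the same subset and the same blocks, and
on each block the labels differ by left multiplication by an element of `G`. -/
def Equivalent [Group G] (p p' : PartialGPartition n G) : Prop :=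
  p.carrier = p'.carrier ∧ (∀ i j, p.Rel i j ↔ p'.Rel i j) ∧
    ∀ i, ∃ g : G, ∀ j (h : j ∈ p.carrier) (h' : j ∈ p'.carrier), p.Rel i j →
      p.label ⟨j, h⟩ = g * p'.label ⟨j, h'⟩

/-- `p'` is obtained from `p` by deleting a block, the block of `i`. -/
def IsDeletion (p p' : PartialGPartition n G) : Prop :=
  ∃ i ∈ p.carrier, p'.carrier = {k | k ∈ p.carrier ∧ ¬ p.Rel i k} ∧
    (∀ k l, p'.Rel k l ↔ p.Rel k l ∧ ¬ p.Rel i k) ∧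
    ∀ k (h : k ∈ p.carrier) (h' : k ∈ p'.carrier), p'.label ⟨k, h'⟩ = p.label ⟨k, h⟩

/-- `p'` is obtained from `p` by merging two different blocks, those of `i` and `j`. -/
def IsMerging (p p' : PartialGPartition n G) : Prop :=
  ∃ i ∈ p.carrier, ∃ j ∈ p.carrier, ¬ p.Rel i j ∧ p'.carrier = p.carrier ∧
    (∀ k l, p'.Rel k l ↔ p.Rel k l ∨ (p.Rel i k ∨ p.Rel j k) ∧ (p.Rel i l ∨ p.Rel j l)) ∧
    ∀ k (h : k ∈ p.carrier) (h' : k ∈ p'.carrier), p'.label ⟨k, h'⟩ = p.label ⟨k, h⟩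

/-- `p` refines `p'` if `p'` is obtained from `p`, up to equivalence, by a sequence of operations
consisting of merging blocks and deleting blocks. -/
def Refines [Group G] : PartialGPartition n G → PartialGPartition n G → Prop :=
  Relation.ReflTransGen fun p p' ↦ p.Equivalent p' ∨ p.IsMerging p' ∨ p.IsDeletion p'

/-- The number of blocks. -/
noncomputable def numBlocks (p : PartialGPartition n G) : ℕ := Nat.card (Quotient p.blocks)

/-! ### A description of the refinement order -/

variable {p p' p'' : PartialGPartition n G} {i j k l : Fin n} {g h : G}

lemma Rel.left (h : p.Rel i j) : i ∈ p.carrier := h.1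
lemma Rel.right (h : p.Rel i j) : j ∈ p.carrier := h.2.1
lemma rel_refl (h : i ∈ p.carrier) : p.Rel i i := ⟨h, h, p.blocks.refl _⟩
lemma Rel.symm (h : p.Rel i j) : p.Rel j i := ⟨h.2.1, h.1, p.blocks.symm h.2.2⟩
lemma Rel.trans (h : p.Rel i j) (h' : p.Rel j k) : p.Rel i k :=
  ⟨h.1, h'.2.1, p.blocks.trans h.2.2 h'.2.2⟩

/-- Delete the block of `i`. -/
def del (p : PartialGPartition n G) (i : Fin n) : PartialGPartition n G where
  carrier := {k | k ∈ p.carrier ∧ ¬ p.Rel i k}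
  label k := p.label ⟨k.1, k.2.1⟩
  blocks := p.blocks.comap fun k ↦ ⟨k.1, k.2.1⟩

lemma numBlocks_le_del (hi : i ∈ p.carrier) : p.numBlocks ≤ (p.del i).numBlocks + 1 := by
  classical
  unfold numBlocks
  rw [← Finite.card_option]
  refine Nat.card_le_card_of_surjective (fun c : Option (Quotient (p.del i).blocks) ↦
    c.elim (⟦⟨i, hi⟩⟧ : Quotient p.blocks) (Quotient.lift (fun k ↦ ⟦⟨k.1, k.2.1⟩⟧)
      fun a b hab ↦ Quotient.sound hab)) ?_
  intro c
  induction c using Quotient.inductionOn with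
  | h k =>
    by_cases hk : p.Rel i k
    · exact ⟨none, Quotient.sound hk.2.2⟩
    · exact ⟨some ⟦⟨k.1, k.2, hk⟩⟧, rfl⟩

lemma del_rel : (p.del i).Rel k l ↔ p.Rel k l ∧ ¬ p.Rel i k :=
  ⟨fun ⟨h1, h2, h3⟩ ↦ ⟨⟨h1.1, h2.1, h3⟩, h1.2⟩,
    fun ⟨h, h'⟩ ↦ ⟨⟨h.left, h'⟩, ⟨h.right, fun h2 ↦ h' (h2.trans h.symm)⟩, h.2.2⟩⟩

/-- Merge the blocks of `i` and `j`. -/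
def merge (p : PartialGPartition n G) (i j : Fin n) : PartialGPartition n G where
  carrier := p.carrier
  label := p.label
  blocks :=
    { r := fun k l ↦ p.Rel k l ∨ (p.Rel i k ∨ p.Rel j k) ∧ (p.Rel i l ∨ p.Rel j l)
      iseqv := by
        refine ⟨fun k ↦ .inl (rel_refl k.2), ?_, ?_⟩
        · rintro k l (h | ⟨h, h'⟩)
          · exact .inl h.symm
          · exact .inr ⟨h', h⟩
        · rintro k l m (h | ⟨h, h'⟩) (h2 | ⟨h2, h3⟩)
          · exact .inl (h.trans h2)
          · exact .inr ⟨h2.imp (·.trans h.symm) (·.trans h.symm), h3⟩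
          · exact .inr ⟨h, h'.imp (·.trans h2) (·.trans h2)⟩
          · exact .inr ⟨h, h3⟩ }

lemma merge_rel : (p.merge i j).Rel k l ↔
    p.Rel k l ∨ (p.Rel i k ∨ p.Rel j k) ∧ (p.Rel i l ∨ p.Rel j l) := by
  constructor
  · rintro ⟨_, _, h⟩
    exact h
  · intro h
    refine ⟨?_, ?_, h⟩
    · rcases h with h | ⟨h | h, _⟩
      exacts [h.left, h.right, h.right]
    · rcases h with h | ⟨_, h | h⟩
      exacts [h.right, h.right, h.right]

lemma isDeletion_del (hi : i ∈ p.carrier) : p.IsDeletion (p.del i) :=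
  ⟨i, hi, rfl, fun _ _ ↦ del_rel, fun _ _ _ ↦ rfl⟩

lemma isMerging_merge (hi : i ∈ p.carrier) (hj : j ∈ p.carrier) (hij : ¬ p.Rel i j) :
    p.IsMerging (p.merge i j) :=
  ⟨i, hi, j, hj, hij, rfl, fun _ _ ↦ merge_rel, fun _ _ _ ↦ rfl⟩

section
variable [Group G]

/-- Either both `i` and `j` are outside of the subset, or they are in the same block, and `g` is the
quotient of their labels. -/
def Edge (p : PartialGPartition n G) (i j : Fin n) (g : G) : Prop :=
  (i ∉ p.carrier ∧ j ∉ p.carrier) ∨ ∃ (hi : i ∈ p.carrier) (hj : j ∈ p.carrier),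
    p.Rel i j ∧ p.label ⟨i, hi⟩ * g = p.label ⟨j, hj⟩

/-- A description of the refinement order, see `refines_iff`. -/
def Le (p p' : PartialGPartition n G) : Prop :=
  (∀ i, i ∉ p.carrier → i ∉ p'.carrier) ∧ ∀ i j g, p.Edge i j g → p'.Edge i j g

lemma edge_of_rel (h : p.Rel i j) :
    p.Edge i j ((p.label ⟨i, h.left⟩)⁻¹ * p.label ⟨j, h.right⟩) :=
  .inr ⟨h.left, h.right, h, by simp⟩

lemma edge_refl (i : Fin n) : p.Edge i i 1 := by
  by_cases h : i ∈ p.carrier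
  · exact .inr ⟨h, h, rel_refl h, mul_one _⟩
  · exact .inl ⟨h, h⟩

lemma Edge.symm (h : p.Edge i j g) : p.Edge j i g⁻¹ := by
  rcases h with ⟨hi, hj⟩ | ⟨hi, hj, hr, he⟩
  · exact .inl ⟨hj, hi⟩
  · exact .inr ⟨hj, hi, hr.symm, by rw [← he]; simp⟩

lemma Edge.trans (h1 : p.Edge i j g) (h2 : p.Edge j k h) : p.Edge i k (g * h) := by
  rcases h1 with ⟨hi, hj⟩ | ⟨hi, hj, hr, he⟩ <;> rcases h2 with ⟨hj', hk⟩ | ⟨hj', hk, hr', he'⟩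
  · exact .inl ⟨hi, hk⟩
  · exact absurd hj' hj
  · exact absurd hj hj'
  · exact .inr ⟨hi, hk, hr.trans hr', by rw [← mul_assoc, he, he']⟩

lemma Edge.notMem (h : p.Edge i j g) (hi : i ∉ p.carrier) : j ∉ p.carrier := by
  rcases h with ⟨_, hj⟩ | ⟨hi', _⟩
  · exact hj
  · exact absurd hi' hi

lemma Edge.mem (h : p.Edge i j g) (hi : i ∈ p.carrier) : j ∈ p.carrier := by
  by_contra hj
  exact h.symm.notMem hj hi

lemma Edge.rel (h : p.Edge i j g) (hi : i ∈ p.carrier) : p.Rel i j := by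
  rcases h with ⟨hi', _⟩ | ⟨_, _, h, _⟩
  · exact absurd hi hi'
  · exact h

lemma Edge.label (h : p.Edge i j g) (hi : i ∈ p.carrier) (hj : j ∈ p.carrier) :
    p.label ⟨i, hi⟩ * g = p.label ⟨j, hj⟩ := by
  rcases h with ⟨hi', _⟩ | ⟨_, _, _, h⟩
  · exact absurd hi hi'
  · exact h

lemma Edge.unique (h1 : p.Edge i j g) (h2 : p.Edge i j h) (hi : i ∈ p.carrier) : g = h :=
  mul_left_cancel ((h1.label hi (h1.mem hi)).trans (h2.label hi (h1.mem hi)).symm)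

lemma edge_of_notMem (hi : i ∉ p.carrier) (hj : j ∉ p.carrier) : p.Edge i j g := .inl ⟨hi, hj⟩

lemma Le.refl (p : PartialGPartition n G) : p.Le p := ⟨fun _ h ↦ h, fun _ _ _ h ↦ h⟩

lemma Le.trans (h : p.Le p') (h' : p'.Le p'') : p.Le p'' :=
  ⟨fun i hi ↦ h'.1 i (h.1 i hi), fun i j g hg ↦ h'.2 i j g (h.2 i j g hg)⟩

lemma Le.mem (h : p.Le p') (hi : i ∈ p'.carrier) : i ∈ p.carrier := by
  by_contra h'
  exact h.1 i h' hi

lemma Equivalent.le (h : p.Equivalent p') : p.Le p' := by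
  obtain ⟨h1, h2, h3⟩ := h
  refine ⟨fun i ↦ by simp [h1], ?_⟩
  rintro i j g (⟨hi, hj⟩ | ⟨hi, hj, hr, he⟩)
  · exact .inl ⟨h1 ▸ hi, h1 ▸ hj⟩
  · obtain ⟨c, hc⟩ := h3 i
    refine .inr ⟨h1 ▸ hi, h1 ▸ hj, (h2 i j).1 hr, ?_⟩
    rw [hc i hi (h1 ▸ hi) (rel_refl hi), hc j hj (h1 ▸ hj) hr, mul_assoc] at he
    exact mul_left_cancel he

lemma equivalent_iff : p.Equivalent p' ↔ p.Le p' ∧ p'.Le p := by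
  constructor
  · intro h
    refine ⟨h.le, Equivalent.le ⟨h.1.symm, fun i j ↦ (h.2.1 i j).symm, fun i ↦ ?_⟩⟩
    obtain ⟨c, hc⟩ := h.2.2 i
    refine ⟨c⁻¹, fun j hj hj' hr ↦ ?_⟩
    rw [hc j hj' hj ((h.2.1 i j).2 hr)]
    simp
  · rintro ⟨h1, h2⟩
    have hS : p.carrier = p'.carrier := by
      ext i; exact ⟨fun h ↦ h2.mem h, fun h ↦ h1.mem h⟩
    refine ⟨hS, fun i j ↦ ⟨fun h ↦ (h1.2 i j _ (edge_of_rel h)).rel (h2.mem h.left),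
      fun h ↦ (h2.2 i j _ (edge_of_rel h)).rel (h1.mem h.left)⟩, fun i ↦ ?_⟩
    by_cases hi : i ∈ p.carrier
    · refine ⟨p.label ⟨i, hi⟩ * (p'.label ⟨i, h2.mem hi⟩)⁻¹, fun j hj hj' hr ↦ ?_⟩
      have := (h1.2 i j _ (edge_of_rel hr)).label (h2.mem hi) hj'
      rw [← this]
      simp [mul_assoc]
    · exact ⟨1, fun j hj hj' hr ↦ absurd hr.left hi⟩

lemma IsDeletion.le (h : p.IsDeletion p') : p.Le p' := by
  obtain ⟨a, ha, h1, h2, h3⟩ := h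
  refine ⟨fun i hi ↦ by simp [h1, hi], ?_⟩
  rintro i j g (⟨hi, hj⟩ | ⟨hi, hj, hr, he⟩)
  · exact .inl ⟨by simp [h1, hi], by simp [h1, hj]⟩
  · by_cases hai : p.Rel a i
    · exact .inl ⟨by simp [h1, hai], by simp [h1, hai.trans hr]⟩
    · have hi' : i ∈ p'.carrier := by simp [h1, hi, hai]
      have hj' : j ∈ p'.carrier := by
        rw [h1]
        exact ⟨hj, fun h ↦ hai (h.trans hr.symm)⟩
      exact .inr ⟨hi', hj', (h2 i j).2 ⟨hr, hai⟩, by rw [h3 i hi hi', h3 j hj hj', he]⟩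

lemma IsMerging.le (h : p.IsMerging p') : p.Le p' := by
  obtain ⟨a, ha, b, hb, hab, h1, h2, h3⟩ := h
  refine ⟨fun i hi ↦ by simp [h1, hi], ?_⟩
  rintro i j g (⟨hi, hj⟩ | ⟨hi, hj, hr, he⟩)
  · exact .inl ⟨by simp [h1, hi], by simp [h1, hj]⟩
  · exact .inr ⟨h1 ▸ hi, h1 ▸ hj, (h2 i j).2 (.inl hr),
      by rw [h3 i hi (h1 ▸ hi), h3 j hj (h1 ▸ hj), he]⟩

lemma del_le_iff (hi : i ∈ p.carrier) : (p.del i).Le p' ↔ p.Le p' ∧ i ∉ p'.carrier := by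
  constructor
  · intro h
    exact ⟨(isDeletion_del hi).le.trans h, h.1 i fun h' ↦ h'.2 (rel_refl hi)⟩
  · rintro ⟨h, hi'⟩
    have key : ∀ k, k ∉ (p.del i).carrier → k ∉ p'.carrier := by
      intro k hk
      by_cases hk' : k ∈ p.carrier
      · have hr : p.Rel i k := by
          by_contra hr
          exact hk ⟨hk', hr⟩
        exact (h.2 _ _ _ (edge_of_rel hr)).notMem hi'
      · exact h.1 k hk'
    refine ⟨key, ?_⟩
    rintro k l g (⟨hk, hl⟩ | ⟨hk, hl, hr, he⟩)
    · exact .inl ⟨key k hk, key l hl⟩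
    · exact h.2 _ _ _ (.inr ⟨hk.1, hl.1, (del_rel.1 hr).1, he⟩)

open Classical in
/-- Relabel the block of `j` so that there is an edge with label `g` from `i` to `j`. -/
noncomputable def relabel (p : PartialGPartition n G) (i j : Fin n) (hi : i ∈ p.carrier)
    (hj : j ∈ p.carrier) (g : G) : PartialGPartition n G where
  carrier := p.carrier
  label k := if p.Rel j k then p.label ⟨i, hi⟩ * g * (p.label ⟨j, hj⟩)⁻¹ * p.label k
    else p.label k
  blocks := p.blocks

lemma equivalent_relabel (hi : i ∈ p.carrier) (hj : j ∈ p.carrier) :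
    p.Equivalent (p.relabel i j hi hj g) := by
  refine ⟨rfl, fun _ _ ↦ Iff.rfl, fun k ↦ ?_⟩
  by_cases hk : p.Rel j k
  · refine ⟨(p.label ⟨i, hi⟩ * g * (p.label ⟨j, hj⟩)⁻¹)⁻¹, fun l h h' hl ↦ ?_⟩
    simp [relabel, hk.trans hl, mul_assoc]
  · refine ⟨1, fun l h h' hl ↦ ?_⟩
    have : ¬ p.Rel j l := fun hh ↦ hk (hh.trans hl.symm)
    simp [relabel, this]

/-- Merge the blocks of `i` and `j` so that there is an edge with label `g` from `i` to `j`. -/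
noncomputable def join (p : PartialGPartition n G) (i j : Fin n) (hi : i ∈ p.carrier)
    (hj : j ∈ p.carrier) (g : G) : PartialGPartition n G := (p.relabel i j hi hj g).merge i j

lemma join_edge (hi : i ∈ p.carrier) (hj : j ∈ p.carrier) (hij : ¬ p.Rel i j) :
    (p.join i j hi hj g).Edge i j g := by
  refine .inr ⟨hi, hj, merge_rel.2 (.inr ⟨.inl (rel_refl hi), .inr (rel_refl hj)⟩), ?_⟩
  have hji : ¬ p.Rel j i := fun h ↦ hij h.symm
  simp [join, merge, relabel, rel_refl hj, hji]

lemma le_join (hi : i ∈ p.carrier) (hj : j ∈ p.carrier) (hij : ¬ p.Rel i j) :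
    p.Le (p.join i j hi hj g) :=
  (equivalent_relabel hi hj).le.trans (isMerging_merge (p := p.relabel i j hi hj g) hi hj hij).le


lemma merge_le (h : p.Le p') (hi : i ∈ p.carrier) (hj : j ∈ p.carrier)
    (he : p'.Edge i j ((p.label ⟨i, hi⟩)⁻¹ * p.label ⟨j, hj⟩)) : (p.merge i j).Le p' := by
  have key : ∀ k (hk : k ∈ p.carrier), p.Rel i k ∨ p.Rel j k →
      p'.Edge i k ((p.label ⟨i, hi⟩)⁻¹ * p.label ⟨k, hk⟩) := by
    rintro k hk (h' | h')
    · exact h.2 _ _ _ (edge_of_rel h')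
    · have := he.trans (h.2 _ _ _ (edge_of_rel h'))
      simpa [mul_assoc] using this
  refine ⟨h.1, ?_⟩
  rintro k l c (⟨hk, hl⟩ | ⟨hk, hl, hr, hc⟩)
  · exact .inl ⟨h.1 k hk, h.1 l hl⟩
  · rcases merge_rel.1 hr with hr | ⟨h1, h2⟩
    · exact h.2 _ _ _ (.inr ⟨hk, hl, hr, hc⟩)
    · have h3 := (key k hk h1).symm.trans (key l hl h2)
      have h4 : p.label ⟨k, hk⟩ * c = p.label ⟨l, hl⟩ := hc
      rw [← h4] at h3
      simpa [mul_assoc] using h3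

lemma join_le_iff (hi : i ∈ p.carrier) (hj : j ∈ p.carrier) (hij : ¬ p.Rel i j) :
    (p.join i j hi hj g).Le p' ↔ p.Le p' ∧ p'.Edge i j g := by
  constructor
  · intro h
    exact ⟨(le_join hi hj hij).trans h, h.2 _ _ _ (join_edge hi hj hij)⟩
  · rintro ⟨h, he⟩
    refine merge_le (p := p.relabel i j hi hj g) (hi := hi) (hj := hj)
      ((equivalent_iff.1 (equivalent_relabel hi hj)).2.trans h) ?_
    have hji : ¬ p.Rel j i := fun h ↦ hij h.symm
    simpa [relabel, rel_refl hj, hji] using he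

lemma numBlocks_le_join (hi : i ∈ p.carrier) (hj : j ∈ p.carrier) :
    p.numBlocks ≤ (p.join i j hi hj g).numBlocks + 1 := by
  classical
  unfold numBlocks
  rw [← Finite.card_option]
  refine Nat.card_le_card_of_surjective (fun c : Option (Quotient (p.join i j hi hj g).blocks) ↦
    c.elim (⟦⟨j, hj⟩⟧ : Quotient p.blocks) (Quotient.lift
      (fun k ↦ if p.Rel j k then ⟦⟨i, hi⟩⟧ else ⟦k⟧) ?_)) ?_
  · rintro a b (hab | ⟨ha, hb⟩)
    · have hab : p.Rel a b := hab
      by_cases h : p.Rel j a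
      · rw [if_pos h, if_pos (h.trans hab)]
      · rw [if_neg h, if_neg fun h' ↦ h (h'.trans hab.symm)]
        exact Quotient.sound hab.2.2
    · have key : ∀ a : p.carrier, p.Rel i a ∨ p.Rel j a →
          (if p.Rel j a then ⟦⟨i, hi⟩⟧ else ⟦a⟧ : Quotient p.blocks) = ⟦⟨i, hi⟩⟧ := by
        rintro a (ha | ha)
        · split_ifs
          · rfl
          · exact Quotient.sound ha.symm.2.2
        · rw [if_pos ha]
      exact (key a ha).trans (key b hb).symm
  · intro c
    induction c using Quotient.inductionOn with
    | h k =>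
      by_cases hk : p.Rel j k
      · exact ⟨none, Quotient.sound hk.2.2⟩
      · exact ⟨some ⟦k⟧, if_neg hk⟩

/-- Choose an element of each block of `p'` and take its block in `p`. -/
noncomputable def blockMap (h : p.Le p') (c : Quotient p'.blocks) : Quotient p.blocks :=
  ⟦⟨c.out.1, h.mem c.out.2⟩⟧

lemma blockMap_injective (h : p.Le p') : Function.Injective (blockMap h) := by
  intro c d hcd
  have hr : p.Rel c.out.1 d.out.1 := ⟨_, _, Quotient.exact hcd⟩
  have := (h.2 _ _ _ (edge_of_rel hr)).rel c.out.2
  rw [← c.out_eq, ← d.out_eq]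
  exact Quotient.sound this.2.2

lemma Le.numBlocks_le (h : p.Le p') : p'.numBlocks ≤ p.numBlocks :=
  Nat.card_le_card_of_injective _ (blockMap_injective h)

lemma Le.le_of_numBlocks_le (h : p.Le p') (hc : p.numBlocks ≤ p'.numBlocks) : p'.Le p := by
  have hs : Function.Surjective (blockMap h) :=
    ((Nat.bijective_iff_injective_and_card _).2 ⟨blockMap_injective h,
      h.numBlocks_le.antisymm hc⟩).2
  have key : ∀ i (hi : i ∈ p.carrier), ∃ c : Quotient p'.blocks, p.Rel c.out.1 i := by
    intro i hi
    obtain ⟨c, hc⟩ := hs ⟦⟨i, hi⟩⟧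
    exact ⟨c, h.mem c.out.2, hi, Quotient.exact hc⟩
  have hmem : ∀ i, i ∉ p'.carrier → i ∉ p.carrier := by
    intro i hi hi'
    obtain ⟨c, hc⟩ := key i hi'
    exact hi ((h.2 _ _ _ (edge_of_rel hc)).mem c.out.2)
  refine ⟨hmem, ?_⟩
  rintro i j g (⟨hi, hj⟩ | ⟨hi, hj, hr, he⟩)
  · exact .inl ⟨hmem i hi, hmem j hj⟩
  · obtain ⟨c, hc⟩ := key i (h.mem hi)
    obtain ⟨d, hd⟩ := key j (h.mem hj)
    have h1 := (h.2 _ _ _ (edge_of_rel hc)).rel c.out.2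
    have h2 := (h.2 _ _ _ (edge_of_rel hd)).rel d.out.2
    have hcd : c = d := by
      rw [← c.out_eq, ← d.out_eq]
      exact Quotient.sound ((h1.trans hr).trans h2.symm).2.2
    subst hcd
    have h3 : p.Rel i j := hc.symm.trans hd
    have h4 := edge_of_rel h3
    rwa [← Edge.unique (.inr ⟨hi, hj, hr, he⟩) (h.2 _ _ _ h4) hi] at h4

lemma Refines.le (h : p.Refines p') : p.Le p' := by
  induction h with
  | refl => exact .refl _
  | tail _ h ih =>
    rcases h with h | h | h
    · exact ih.trans h.le
    · exact ih.trans h.le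
    · exact ih.trans h.le

lemma Le.refines (h : p.Le p') : p.Refines p' := by
  induction hm : p.numBlocks using Nat.strong_induction_on generalizing p with
  | _ m ih =>
  subst hm
  by_cases h' : p'.Le p
  · exact .single (.inl (equivalent_iff.2 ⟨h, h'⟩))
  have step : ∀ {q : PartialGPartition n G}, p.Le q → ¬ q.Le p → q.Le p' → q.Refines p' := by
    intro q hq hq' hqp
    refine ih _ ?_ hqp rfl
    by_contra hc
    exact hq' (hq.le_of_numBlocks_le (not_lt.1 hc))
  by_cases hS : ∃ i, i ∉ p'.carrier ∧ i ∈ p.carrier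
  · obtain ⟨i, hi', hi⟩ := hS
    have hle := (del_le_iff hi).2 ⟨h, hi'⟩
    refine .head (.inr (.inr (isDeletion_del hi))) (step (isDeletion_del hi).le ?_ hle)
    exact fun hh ↦ hh.1 i (fun h2 ↦ h2.2 (rel_refl hi)) hi
  · have hS' : ∀ i, i ∉ p'.carrier → i ∉ p.carrier := fun i h1 h2 ↦ hS ⟨i, h1, h2⟩
    have : ∃ i j g, p'.Edge i j g ∧ ¬ p.Edge i j g := by
      by_contra hc
      push Not at hc
      exact h' ⟨hS', hc⟩
    obtain ⟨i, j, g, he, hne⟩ := this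
    have hi : i ∈ p'.carrier := by
      by_contra hi
      exact hne (.inl ⟨hS' i hi, hS' j (he.notMem hi)⟩)
    have hi1 := h.mem hi
    have hj1 := h.mem (he.mem hi)
    have hr : ¬ p.Rel i j := by
      intro hr
      have h1 := edge_of_rel hr
      rw [(h.2 _ _ _ h1).unique he hi] at h1
      exact hne h1
    refine .head (.inl (equivalent_relabel (g := g) hi1 hj1))
      (.head (.inr (.inl (isMerging_merge (p := p.relabel i j hi1 hj1 g) hi1 hj1 hr)))
        (step (le_join hi1 hj1 hr) (fun hh ↦ hne (hh.2 _ _ _ (join_edge hi1 hj1 hr)))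
          ((join_le_iff hi1 hj1 hr).2 ⟨h, he⟩)))

lemma refines_iff : p.Refines p' ↔ p.Le p' := ⟨Refines.le, Le.refines⟩

variable (n G) in
/-- Equivalence of partial `G`-partitions. -/
instance setoid : Setoid (PartialGPartition n G) where
  r := Equivalent
  iseqv := ⟨fun p ↦ equivalent_iff.2 ⟨.refl p, .refl p⟩,
    fun h ↦ equivalent_iff.2 (equivalent_iff.1 h).symm,
    fun h h' ↦ equivalent_iff.2 ⟨(equivalent_iff.1 h).1.trans (equivalent_iff.1 h').1,
      (equivalent_iff.1 h').2.trans (equivalent_iff.1 h).2⟩⟩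

end

instance [Finite G] : Finite (PartialGPartition n G) := by
  have : ∀ S : Set (Fin n), Finite (Setoid S) := fun S ↦
    Finite.of_injective (fun s : Setoid S ↦ s.r) fun s t h ↦ Setoid.ext fun a b ↦ by
      exact iff_of_eq (congrFun (congrFun h a) b)
  refine Finite.of_surjective (fun x : Σ S : Set (Fin n), (S → G) × Setoid S ↦
    (⟨x.1, x.2.1, x.2.2⟩ : PartialGPartition n G)) ?_
  rintro ⟨S, f, b⟩
  exact ⟨⟨S, f, b⟩, rfl⟩

end PartialGPartition

/-- The poset of equivalence classes of partial `G`-partitions of `[n]`, ordered by refinement. -/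
def DowlingLattice (n : ℕ) (G : Type*) [Group G] : Type _ := Quotient (PartialGPartition.setoid n G)

namespace DowlingLattice

open PartialGPartition

variable {n : ℕ} {G : Type*} [Group G]

instance [Finite G] : Finite (DowlingLattice n G) :=
  inferInstanceAs (Finite (Quotient (PartialGPartition.setoid n G)))

/-- The class of a partial `G`-partition. -/
def mk (p : PartialGPartition n G) : DowlingLattice n G := Quotient.mk _ p

lemma mk_surj (x : DowlingLattice n G) : ∃ p, mk p = x := Quotient.exists_rep x

/-- The refinement order. -/
instance : PartialOrder (DowlingLattice n G) where
  le := Quotient.lift₂ Refines fun a b c d h h' ↦ by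
    simp only [refines_iff]
    have h := equivalent_iff.1 h
    have h' := equivalent_iff.1 h'
    exact propext ⟨fun hh ↦ (h.2.trans hh).trans h'.1, fun hh ↦ (h.1.trans hh).trans h'.2⟩
  le_refl := by
    rintro ⟨p⟩
    exact refines_iff.2 (.refl p)
  le_trans := by
    rintro ⟨p⟩ ⟨q⟩ ⟨r⟩ h h'
    exact Relation.ReflTransGen.trans h h'
  le_antisymm := by
    rintro ⟨p⟩ ⟨q⟩ h h'
    exact Quotient.sound (equivalent_iff.2 ⟨refines_iff.1 h, refines_iff.1 h'⟩)

lemma mk_le_mk {p q : PartialGPartition n G} : mk p ≤ mk q ↔ p.Le q := refines_iff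

/-- The partition of `[n]` into singletons. -/
def singletons (n : ℕ) (G : Type*) [Group G] : PartialGPartition n G where
  carrier := Set.univ
  label _ := 1
  blocks := ⊥

lemma singletons_rel {i j : Fin n} : (singletons n G).Rel i j ↔ i = j := by
  constructor
  · rintro ⟨_, _, h⟩
    exact congrArg Subtype.val (show (⟨i, _⟩ : (singletons n G).carrier) = ⟨j, _⟩ from h)
  · rintro rfl
    exact rel_refl (Set.mem_univ _)

lemma singletons_edge {i j : Fin n} {g : G} : (singletons n G).Edge i j g ↔ i = j ∧ g = 1 := by
  constructor
  · rintro (⟨h, _⟩ | ⟨_, _, h, he⟩)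
    · exact absurd (Set.mem_univ _) h
    · refine ⟨singletons_rel.1 h, ?_⟩
      simpa [singletons] using he
  · rintro ⟨rfl, rfl⟩
    exact edge_refl _

lemma singletons_le (p : PartialGPartition n G) : (singletons n G).Le p := by
  refine ⟨fun i h ↦ absurd (Set.mem_univ _) h, fun i j g h ↦ ?_⟩
  obtain ⟨rfl, rfl⟩ := singletons_edge.1 h
  exact edge_refl _

instance : OrderBot (DowlingLattice n G) where
  bot := mk (singletons n G)
  bot_le := by
    rintro ⟨p⟩
    exact mk_le_mk.2 (singletons_le p)

/-- The number of blocks. -/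
noncomputable def numBlocks : DowlingLattice n G → ℕ :=
  Quotient.lift PartialGPartition.numBlocks fun _ _ h ↦
    (equivalent_iff.1 h).2.numBlocks_le.antisymm (equivalent_iff.1 h).1.numBlocks_le

/-- The rank of a class of partial `G`-partitions of `[n]` with `k` blocks is `n - k`. -/
noncomputable def rank (x : DowlingLattice n G) : ℕ := n - x.numBlocks

lemma numBlocks_bot : (⊥ : DowlingLattice n G).numBlocks = n := by
  change Nat.card (Quotient (⊥ : Setoid (Set.univ : Set (Fin n)))) = n
  rw [Nat.card_congr (β := Fin n) ⟨Quotient.lift (fun i ↦ i.1) fun a b h ↦ congrArg Subtype.val h,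
    fun i ↦ Quotient.mk _ ⟨i, Set.mem_univ i⟩, fun x ↦ ?_, fun _ ↦ rfl⟩, Nat.card_fin]
  induction x using Quotient.inductionOn
  rfl

lemma numBlocks_anti {x y : DowlingLattice n G} (h : x ≤ y) : y.numBlocks ≤ x.numBlocks := by
  obtain ⟨p, rfl⟩ := mk_surj x
  obtain ⟨q, rfl⟩ := mk_surj y
  exact (mk_le_mk.1 h).numBlocks_le

lemma numBlocks_le (x : DowlingLattice n G) : x.numBlocks ≤ n :=
  (numBlocks_anti bot_le).trans numBlocks_bot.le

lemma rank_bot : (⊥ : DowlingLattice n G).rank = 0 := by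
  rw [rank, numBlocks_bot, Nat.sub_self]

lemma rank_mono {x y : DowlingLattice n G} (h : x ≤ y) : x.rank ≤ y.rank :=
  Nat.sub_le_sub_left (numBlocks_anti h) n

lemma eq_of_rank_le {x y : DowlingLattice n G} (h : x ≤ y) (hr : y.rank ≤ x.rank) : x = y := by
  refine h.antisymm ?_
  have h1 := x.numBlocks_le
  have h2 := y.numBlocks_le
  obtain ⟨p, rfl⟩ := mk_surj x
  obtain ⟨q, rfl⟩ := mk_surj y
  unfold rank at hr
  exact mk_le_mk.2 ((mk_le_mk.1 h).le_of_numBlocks_le (show (mk p).numBlocks ≤ (mk q).numBlocks by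
    omega))

/-- Atoms are the elements given by deleting a singleton or merging two singletons. -/
lemma atom_cases {a : DowlingLattice n G} (ha : IsAtom a) :
    (∃ i, ∀ p : PartialGPartition n G, a ≤ mk p ↔ i ∉ p.carrier) ∨
      ∃ i j g, ∀ p : PartialGPartition n G, a ≤ mk p ↔ p.Edge i j g := by
  obtain ⟨q, rfl⟩ := mk_surj a
  by_cases hS : ∃ i, i ∉ q.carrier
  · obtain ⟨i, hi⟩ := hS
    have hi0 : i ∈ (singletons n G).carrier := Set.mem_univ i
    have key : ∀ p : PartialGPartition n G, ((singletons n G).del i).Le p ↔ i ∉ p.carrier :=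
      fun p ↦ (del_le_iff hi0).trans (and_iff_right (singletons_le p))
    have h1 : mk ((singletons n G).del i) = mk q := by
      refine (ha.le_iff_eq fun h0 ↦ ?_).1 (mk_le_mk.2 ((key q).2 hi))
      exact (key (singletons n G)).1 (mk_le_mk.1 h0.le) hi0
    exact .inl ⟨i, fun p ↦ by rw [← h1, mk_le_mk, key]⟩
  · have hS : ∀ i, i ∈ q.carrier := by simpa using hS
    have : ∃ i j g, q.Edge i j g ∧ ¬ (singletons n G).Edge i j g := by
      by_contra hc
      push Not at hc
      exact ha.1 (le_bot_iff.1 (mk_le_mk.2 ⟨fun i h ↦ absurd (hS i) h, hc⟩))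
    obtain ⟨i, j, g, he, hne⟩ := this
    have hi0 : i ∈ (singletons n G).carrier := Set.mem_univ i
    have hj0 : j ∈ (singletons n G).carrier := Set.mem_univ j
    have hij : ¬ (singletons n G).Rel i j := by
      intro h
      obtain rfl := singletons_rel.1 h
      refine hne (singletons_edge.2 ⟨rfl, he.unique (edge_refl i) (hS i)⟩)
    have key : ∀ p : PartialGPartition n G,
        ((singletons n G).join i j hi0 hj0 g).Le p ↔ p.Edge i j g :=
      fun p ↦ (join_le_iff hi0 hj0 hij).trans (and_iff_right (singletons_le p))
    have h1 : mk ((singletons n G).join i j hi0 hj0 g) = mk q := by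
      refine (ha.le_iff_eq fun h0 ↦ ?_).1 (mk_le_mk.2 ((key q).2 he))
      exact hne ((key (singletons n G)).1 (mk_le_mk.1 h0.le))
    exact .inr ⟨i, j, g, fun p ↦ by rw [← h1, mk_le_mk, key]⟩

/-- The join of an element and an atom exists, and the rank goes up by at most one. -/
lemma exists_join (x : DowlingLattice n G) {a : DowlingLattice n G} (ha : IsAtom a) :
    ∃ z : DowlingLattice n G, (∀ y, z ≤ y ↔ x ≤ y ∧ a ≤ y) ∧ z.rank ≤ x.rank + 1 := by
  suffices ∃ z : DowlingLattice n G, (∀ y, z ≤ y ↔ x ≤ y ∧ a ≤ y) ∧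
      x.numBlocks ≤ z.numBlocks + 1 by
    obtain ⟨z, h1, h2⟩ := this
    exact ⟨z, h1, by unfold rank; omega⟩
  by_cases hax : a ≤ x
  · exact ⟨x, fun y ↦ ⟨fun h ↦ ⟨h, hax.trans h⟩, fun h ↦ h.1⟩, Nat.le_succ _⟩
  obtain ⟨p, rfl⟩ := mk_surj x
  have hdel : ∀ i, i ∈ p.carrier → (∀ q : PartialGPartition n G, p.Le q →
      (i ∉ q.carrier ↔ a ≤ mk q)) → ∃ z : DowlingLattice n G, (∀ y, z ≤ y ↔ mk p ≤ y ∧ a ≤ y) ∧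
      (mk p).numBlocks ≤ z.numBlocks + 1 := by
    intro i hi hq
    refine ⟨mk (p.del i), fun y ↦ ?_, numBlocks_le_del hi⟩
    obtain ⟨q, rfl⟩ := mk_surj y
    rw [mk_le_mk, mk_le_mk, del_le_iff hi]
    exact and_congr_right (hq q)
  rcases atom_cases ha with ⟨i, hai⟩ | ⟨i, j, g, hae⟩
  · refine hdel i ?_ fun q _ ↦ (hai q).symm
    rw [hai] at hax
    exact not_not.1 hax
  · rw [hae] at hax
    by_cases hi : i ∈ p.carrier
    · by_cases hj : j ∈ p.carrier
      · by_cases hr : p.Rel i j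
        · refine hdel i hi fun q hq ↦ ?_
          have h1 := hq.2 _ _ _ (edge_of_rel hr)
          rw [hae]
          constructor
          · exact fun h ↦ edge_of_notMem h (h1.notMem h)
          · intro h hiq
            have h2 := edge_of_rel hr
            rw [h1.unique h hiq] at h2
            exact hax h2
        · refine ⟨mk (p.join i j hi hj g), fun y ↦ ?_, numBlocks_le_join hi hj⟩
          obtain ⟨q, rfl⟩ := mk_surj y
          rw [mk_le_mk, mk_le_mk, hae, join_le_iff hi hj hr]
      · refine hdel i hi fun q hq ↦ ?_
        rw [hae]
        exact ⟨fun h ↦ edge_of_notMem h (hq.1 j hj), fun h ↦ h.symm.notMem (hq.1 j hj)⟩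
    · have hj : j ∈ p.carrier := by
        by_contra hj
        exact hax (edge_of_notMem hi hj)
      refine hdel j hj fun q hq ↦ ?_
      rw [hae]
      exact ⟨fun h ↦ edge_of_notMem (hq.1 i hi) h, fun h ↦ h.notMem (hq.1 i hi)⟩

lemma exists_isLUB_insert {I : Set {a : DowlingLattice n G // IsAtom a}} {z : DowlingLattice n G}
    (hz : IsLUB (Subtype.val '' I) z) (a : {a : DowlingLattice n G // IsAtom a}) :
    ∃ z', IsLUB (Subtype.val '' insert a I) z' ∧ z'.rank ≤ z.rank + 1 ∧
      (¬ a.1 ≤ z → z'.rank = z.rank + 1) := by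
  obtain ⟨z', h1, h2⟩ := exists_join z a.2
  have h3 := (h1 z').1 le_rfl
  refine ⟨z', ?_, h2, fun ha ↦ h2.antisymm ?_⟩
  · rw [isLUB_iff_le_iff]
    intro y
    rw [h1, isLUB_le_iff hz, Set.image_insert_eq, upperBounds_insert]
    exact and_comm
  · by_contra hc
    have := eq_of_rank_le h3.1 (by omega)
    exact ha (this ▸ h3.2)

lemma exists_isLUB_union [Finite G] {I : Set {a : DowlingLattice n G // IsAtom a}}
    {z : DowlingLattice n G} (hz : IsLUB (Subtype.val '' I) z)
    (J : Set {a : DowlingLattice n G // IsAtom a}) :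
    ∃ z', IsLUB (Subtype.val '' (J ∪ I)) z' ∧ z'.rank ≤ z.rank + J.ncard := by
  induction J, J.toFinite using Set.Finite.induction_on with
  | empty => exact ⟨z, by simpa using hz, by simp⟩
  | @insert a J haJ hJ ih =>
    obtain ⟨z', h1, h2⟩ := ih
    obtain ⟨z'', h3, h4, _⟩ := exists_isLUB_insert h1 a
    refine ⟨z'', by rwa [Set.insert_union], ?_⟩
    rw [Set.ncard_insert_of_notMem haJ hJ]
    omega

lemma isLUB_empty_bot :
    IsLUB (Subtype.val '' (∅ : Set {a : DowlingLattice n G // IsAtom a})) ⊥ := by simp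

lemma exists_isLUB [Finite G] (I : Set {a : DowlingLattice n G // IsAtom a}) :
    ∃ z, IsLUB (Subtype.val '' I) z ∧ z.rank ≤ I.ncard := by
  simpa [rank_bot] using exists_isLUB_union isLUB_empty_bot I

end DowlingLattice

/-- The Dowling geometry `Q_n(G)`: the simple matroid on the atoms of the lattice of partial
`G`-partitions of `[n]` for which a set of atoms is independent if the rank of its join is equal to
its cardinality. -/
noncomputable def dowlingGeometry (n : ℕ) (G : Type*) [Group G] [Finite G] :
    Matroid {a : DowlingLattice n G // IsAtom a} :=
  (IndepMatroid.ofFinite (Set.toFinite Set.univ)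
    (fun I ↦ ∃ z : DowlingLattice n G, IsLUB (Subtype.val '' I) z ∧ z.rank = I.ncard)
    ⟨⊥, DowlingLattice.isLUB_empty_bot, by simp [DowlingLattice.rank_bot]⟩
    (by
      rintro I J ⟨z, hz, hr⟩ hIJ
      obtain ⟨w, hw, hwr⟩ := DowlingLattice.exists_isLUB I
      obtain ⟨z', hz', hr'⟩ := DowlingLattice.exists_isLUB_union hw (J \ I)
      rw [Set.sdiff_union_of_subset hIJ] at hz'
      obtain rfl := hz.unique hz'
      have := Set.ncard_sdiff_add_ncard_of_subset hIJ
      exact ⟨w, hw, by omega⟩)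
    (by
      rintro I J ⟨z, hz, hr⟩ ⟨w, hw, hwr⟩ hlt
      have : ∃ e ∈ J, ¬ e.1 ≤ z := by
        by_contra hc
        push Not at hc
        have : w ≤ z := (isLUB_le_iff hw).2 (by rintro _ ⟨e, he, rfl⟩; exact hc e he)
        have := DowlingLattice.rank_mono this
        omega
      obtain ⟨e, heJ, he⟩ := this
      have heI : e ∉ I := fun h ↦ he (hz.1 ⟨e, h, rfl⟩)
      obtain ⟨z', h1, _, h2⟩ := DowlingLattice.exists_isLUB_insert hz e
      exact ⟨e, heJ, heI, z', h1, by rw [h2 he, Set.ncard_insert_of_notMem heI, hr]⟩)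
    (fun _ _ ↦ Set.subset_univ _)).matroid

namespace DowlingLattice

open PartialGPartition

variable {n : ℕ} {G : Type*} [Group G]

lemma isAtom_of_rank_le {x : DowlingLattice n G} (h0 : x ≠ ⊥) (h1 : x.rank ≤ 1) : IsAtom x := by
  refine ⟨h0, fun y hy ↦ ?_⟩
  have h2 : y.rank < x.rank := by
    by_contra hc
    exact hy.ne (eq_of_rank_le hy.le (not_lt.1 hc))
  exact (eq_of_rank_le bot_le (by omega)).symm

/-- The lattice is atomistic. -/
lemma le_of_forall_atom {x y : DowlingLattice n G} (h : ∀ a, IsAtom a → a ≤ x → a ≤ y) :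
    x ≤ y := by
  obtain ⟨p, rfl⟩ := mk_surj x
  obtain ⟨q, rfl⟩ := mk_surj y
  have hb := numBlocks_bot (n := n) (G := G)
  have hmem : ∀ i, i ∉ p.carrier → i ∉ q.carrier := by
    intro i hi
    have hi0 : i ∈ (singletons n G).carrier := Set.mem_univ i
    have key : ∀ p : PartialGPartition n G, mk ((singletons n G).del i) ≤ mk p ↔ i ∉ p.carrier :=
      fun p ↦ mk_le_mk.trans ((del_le_iff hi0).trans (and_iff_right (singletons_le p)))
    refine (key q).1 (h _ (isAtom_of_rank_le (fun h0 ↦ (key _).1 h0.le hi0) ?_) ((key p).2 hi))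
    have : (⊥ : DowlingLattice n G).numBlocks ≤ (mk ((singletons n G).del i)).numBlocks + 1 :=
      numBlocks_le_del hi0
    unfold rank
    omega
  refine mk_le_mk.2 ⟨hmem, fun i j g he ↦ ?_⟩
  by_cases hij : i = j
  · subst hij
    by_cases hi : i ∈ p.carrier
    · rw [he.unique (edge_refl i) hi]
      exact edge_refl i
    · exact edge_of_notMem (hmem i hi) (hmem i hi)
  have hi0 : i ∈ (singletons n G).carrier := Set.mem_univ i
  have hj0 : j ∈ (singletons n G).carrier := Set.mem_univ j
  have key : ∀ p : PartialGPartition n G,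
      mk ((singletons n G).join i j hi0 hj0 g) ≤ mk p ↔ p.Edge i j g :=
    fun p ↦ mk_le_mk.trans ((join_le_iff hi0 hj0 fun h ↦ hij (singletons_rel.1 h)).trans
      (and_iff_right (singletons_le p)))
  refine (key q).1 (h _ (isAtom_of_rank_le
    (fun h0 ↦ hij (singletons_edge.1 ((key _).1 h0.le)).1) ?_) ((key p).2 he))
  have : (⊥ : DowlingLattice n G).numBlocks ≤
      (mk ((singletons n G).join i j hi0 hj0 g)).numBlocks + 1 := numBlocks_le_join hi0 hj0
  unfold rank
  omega

end DowlingLattice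

section flats

variable {n : ℕ} {G : Type*} [Group G] [Finite G]

lemma dowlingGeometry_indep_iff {I : Set {a : DowlingLattice n G // IsAtom a}} :
    (dowlingGeometry n G).Indep I ↔
      ∃ z : DowlingLattice n G, IsLUB (Subtype.val '' I) z ∧ z.rank = I.ncard := by
  simp [dowlingGeometry]

lemma dowlingGeometry_ground : (dowlingGeometry n G).E = Set.univ := rfl

lemma dowlingGeometry_closure {X : Set {a : DowlingLattice n G // IsAtom a}}
    {z : DowlingLattice n G} (hz : IsLUB (Subtype.val '' X) z) :
    (dowlingGeometry n G).closure X = {a | a.1 ≤ z} := by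
  obtain ⟨I, hI⟩ := (dowlingGeometry n G).exists_isBasis X (Set.subset_univ X)
  obtain ⟨w, hw, hr⟩ := dowlingGeometry_indep_iff.1 hI.indep
  have key : (dowlingGeometry n G).closure I = {a | a.1 ≤ w} := by
    ext a
    rw [hI.indep.mem_closure_iff', Set.mem_ofPred_eq]
    constructor
    · rintro ⟨_, h⟩
      by_contra ha
      obtain ⟨w', h1, _, h2⟩ := DowlingLattice.exists_isLUB_insert hw a
      have haI : a ∉ I := fun h ↦ ha (hw.1 ⟨a, h, rfl⟩)
      exact haI (h (dowlingGeometry_indep_iff.2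
        ⟨w', h1, by rw [h2 ha, Set.ncard_insert_of_notMem haI, hr]⟩))
    · refine fun ha ↦ ⟨Set.mem_univ _, fun h ↦ ?_⟩
      by_contra haI
      obtain ⟨w', hw', hr'⟩ := dowlingGeometry_indep_iff.1 h
      rw [Set.ncard_insert_of_notMem haI] at hr'
      have : w' ≤ w := (isLUB_le_iff hw').2 (by
        rintro _ ⟨b, rfl | hb, rfl⟩
        · exact ha
        · exact hw.1 ⟨b, hb, rfl⟩)
      have := DowlingLattice.rank_mono this
      omega
  have hwz : w = z := by
    refine le_antisymm ((isLUB_le_iff hw).2 ?_) ((isLUB_le_iff hz).2 ?_)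
    · rintro _ ⟨b, hb, rfl⟩
      exact hz.1 ⟨b, hI.subset hb, rfl⟩
    · rintro _ ⟨b, hb, rfl⟩
      have : b ∈ (dowlingGeometry n G).closure I := hI.subset_closure hb
      rwa [key] at this
  rw [← hI.closure_eq_closure, key, hwz]

/-- The lattice of partial `G`-partitions is the lattice of flats of the Dowling geometry. -/
theorem dowlingGeometry_flats : ∃ e : DowlingLattice n G ≃o
    {F : Set {a : DowlingLattice n G // IsAtom a} // (dowlingGeometry n G).IsFlat F},
    ∀ x, (e x).1 = {a | a.1 ≤ x} := by
  have hlub : ∀ x : DowlingLattice n G,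
      IsLUB (Subtype.val '' {a : {a : DowlingLattice n G // IsAtom a} | a.1 ≤ x}) x := by
    intro x
    refine ⟨by rintro _ ⟨b, hb, rfl⟩; exact hb, fun y hy ↦ ?_⟩
    exact DowlingLattice.le_of_forall_atom fun a ha hax ↦ hy ⟨⟨a, ha⟩, hax, rfl⟩
  let f : DowlingLattice n G ↪o
      {F : Set {a : DowlingLattice n G // IsAtom a} // (dowlingGeometry n G).IsFlat F} :=
    OrderEmbedding.ofMapLEIff (fun x ↦ ⟨{a | a.1 ≤ x}, by
      rw [Matroid.isFlat_iff_closure_eq, dowlingGeometry_closure (hlub x)]⟩) (by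
      intro x y
      constructor
      · exact fun h ↦ DowlingLattice.le_of_forall_atom fun a ha hax ↦ h (a := ⟨a, ha⟩) hax
      · exact fun h a ha ↦ le_trans ha h)
  refine ⟨RelIso.ofSurjective f ?_, fun x ↦ rfl⟩
  rintro ⟨F, hF⟩
  obtain ⟨z, hz, _⟩ := DowlingLattice.exists_isLUB F
  exact ⟨z, Subtype.ext ((dowlingGeometry_closure hz).symm.trans hF.closure)⟩

/-- The Dowling geometry is loopless. -/
lemma dowlingGeometry_loopless : (dowlingGeometry n G).Loopless := by
  rw [Matroid.loopless_iff]
  refine (dowlingGeometry_closure DowlingLattice.isLUB_empty_bot).trans ?_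
  ext a
  simpa using a.2.1

end flats

/-- A polynomial is real-rooted if all of its complex roots are real. -/
def IsRealRooted (p : Polynomial ℤ) : Prop := ∀ z : ℂ, Polynomial.aeval z p = 0 → z.im = 0

/-!
The elements of a Dowling lattice above a class with `k` blocks form the Dowling lattice on `k`
letters. Hence the recursion for Kazhdan–Lusztig and `Z`-polynomials stays within the Dowling
geometries of a fixed group and involves nothing but their Whitney numbers of the second kind, which
are polynomials in the order of the group. So are the coefficients of both polynomials, and also the
numerators and denominators of their values at points that depend rationally on the order. For each
`n ≤ 15` there are such points, one for each root, at which the signs alternate for every group: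
written as polynomials in the order minus one, the numbers in question have nonnegative
coefficients up to the expected sign. This locates all roots but one, and that one is real for
reasons of degree.
-/

/-! ### Real-rootedness from sign changes -/

section RealRooted

open Polynomial

lemma exists_isRoot_Ioo_of_neg_one_pow_mul_eval_pos {q : ℝ[X]} {a b : ℝ} (hab : a < b) (i : ℕ)
    (hb : 0 < (-1) ^ i * q.eval b) (ha : 0 < (-1) ^ (i + 1) * q.eval a) :
    ∃ r ∈ Set.Ioo a b, q.IsRoot r := by
  have ha' : (-1) ^ i * q.eval a < 0 := by rw [pow_succ] at ha; linarith
  obtain ⟨r, hr, h0⟩ := intermediate_value_Ioo hab.le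
    (continuous_const.mul q.continuous).continuousOn ⟨ha', hb⟩
  exact ⟨r, hr, by simpa using h0⟩

lemma le_card_roots_of_alternating {q : ℝ[X]} {d : ℕ} {x : Fin (d + 1) → ℝ} (hx : StrictAnti x)
    (hs : ∀ i : Fin (d + 1), 0 < (-1) ^ (i : ℕ) * q.eval (x i)) : d ≤ q.roots.card := by
  choose r hr hroot using fun i : Fin d ↦ exists_isRoot_Ioo_of_neg_one_pow_mul_eval_pos
    (hx i.castSucc_lt_succ) i (hs i.castSucc) (hs i.succ)
  have hq : q ≠ 0 := by
    rintro rfl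
    simpa using hs 0
  have hinj : Function.Injective r := StrictAnti.injective fun i j hij ↦
    (hr j).2.trans_le ((hx.antitone (Fin.succ_le_castSucc_iff.2 hij)).trans (hr i).1.le)
  calc d = (Finset.univ.image r).card := by simp [Finset.card_image_of_injective _ hinj]
    _ ≤ q.roots.toFinset.card := Finset.card_le_card fun t ht ↦ by
      obtain ⟨i, -, rfl⟩ := Finset.mem_image.1 ht
      exact Multiset.mem_toFinset.2 ((mem_roots hq).2 (hroot i))
    _ ≤ q.roots.card := q.roots.toFinset_card_le

lemma splits_of_natDegree_le_card_roots_add_one {K : Type*} [Field K] {q : K[X]}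
    (h : q.natDegree ≤ q.roots.card + 1) : q.Splits := by
  obtain ⟨f, hf, hdeg, -⟩ := exists_prod_multiset_X_sub_C_mul q
  rw [← hf]
  refine (Splits.multisetProd ?_).mul (Splits.of_natDegree_le_one (by omega))
  simp only [Multiset.mem_map]
  rintro _ ⟨a, -, rfl⟩
  exact Splits.X_sub_C a

lemma isRealRooted_of_splits {p : ℤ[X]} (h0 : p ≠ 0) (h : (p.map (algebraMap ℤ ℝ)).Splits) :
    IsRealRooted p := by
  intro z hz
  have h0' : p.map (algebraMap ℤ ℝ) ≠ 0 := (Polynomial.map_ne_zero_iff Int.cast_injective).2 h0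
  have hz' : ((p.map (algebraMap ℤ ℝ)).map (algebraMap ℝ ℂ)).IsRoot z := by
    rw [IsRoot, eval_map_algebraMap, aeval_map_algebraMap, hz]
  obtain ⟨r, rfl⟩ := h.mem_range_of_isRoot h0' hz'
  exact Complex.ofReal_im r

/-- The signs at `d + 1` points produce `d` real roots, and the last root of a polynomial of degree
`d + 1` is then real too. -/
theorem isRealRooted_of_alternating {p : ℤ[X]} {d : ℕ} (hd : p.natDegree ≤ d + 1)
    {x : Fin (d + 1) → ℝ} (hx : StrictAnti x)
    (hs : ∀ i : Fin (d + 1), 0 < (-1) ^ (i : ℕ) * aeval (x i) p) : IsRealRooted p := by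
  have h0 : p ≠ 0 := by
    rintro rfl
    simpa using hs 0
  refine isRealRooted_of_splits h0 (splits_of_natDegree_le_card_roots_add_one ?_)
  calc (p.map (algebraMap ℤ ℝ)).natDegree ≤ p.natDegree := natDegree_map_le
    _ ≤ d + 1 := hd
    _ ≤ _ := Nat.succ_le_succ (le_card_roots_of_alternating hx
      (by simpa only [eval_map_algebraMap] using hs))

end RealRooted

/-! ### Rank functions and contractions -/

/-- A strictly monotone `ℕ`-valued function which, as long as it is nonzero, can be decreased by
at most one by passing to some smaller element. On the lattice of flats of a matroid this describes
the rank. -/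
structure IsRankFunction {L : Type*} [Preorder L] (r : L → ℕ) : Prop where
  strictMono : StrictMono r
  exists_lt : ∀ x, r x ≠ 0 → ∃ y < x, r x ≤ r y + 1

namespace IsRankFunction

variable {L L' : Type*} [Preorder L] [Preorder L'] {r s : L → ℕ}

lemma le_of_strictMono (hr : IsRankFunction r) (hs : StrictMono s) (x : L) : r x ≤ s x := by
  induction h : r x using Nat.strong_induction_on generalizing x with
  | _ k ih =>
    subst h
    by_cases h0 : r x = 0
    · exact h0 ▸ Nat.zero_le _
    · obtain ⟨y, hy, hxy⟩ := hr.exists_lt x h0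
      calc r x ≤ r y + 1 := hxy
        _ ≤ s y + 1 := Nat.succ_le_succ (ih _ (hr.strictMono hy) y rfl)
        _ ≤ s x := hs hy

theorem unique (hr : IsRankFunction r) (hs : IsRankFunction s) : r = s :=
  funext fun x ↦ (hr.le_of_strictMono hs.strictMono x).antisymm
    (hs.le_of_strictMono hr.strictMono x)

lemma comp_orderIso (hr : IsRankFunction r) (e : L' ≃o L) : IsRankFunction (r ∘ e) where
  strictMono := hr.strictMono.comp e.strictMono
  exists_lt x hx := by
    obtain ⟨y, hy, hxy⟩ := hr.exists_lt (e x) hx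
    exact ⟨e.symm y, e.symm_apply_lt.2 hy, by simpa using hxy⟩

end IsRankFunction

section Flats

open scoped Matroid

variable {α : Type*} {M : Matroid α} {F K : Set α}

lemma coe_natRk [Finite α] (M : Matroid α) (X : Set α) : (M.natRk X : ℕ∞) = M.eRk X :=
  ENat.natCast_toNat (M.eRk_ne_top_iff.2 (M.isRkFinite_set X))

lemma isRankFunction_natRk [Finite α] (M : Matroid α) :
    IsRankFunction fun F : {F : Set α // M.IsFlat F} ↦ M.natRk F.1 where
  strictMono F K hFK := by
    obtain ⟨a, haK, haF⟩ := Set.exists_of_ssubset (show F.1 ⊂ K.1 from hFK)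
    rw [← Nat.add_one_le_iff, ← ENat.natCast_le_natCast, Nat.cast_add_one, coe_natRk, coe_natRk,
      ← M.eRk_insert_eq_add_one ⟨K.2.subset_ground haK, F.2.closure.symm ▸ haF⟩]
    exact M.eRk_mono (Set.insert_subset haK hFK.le)
  exists_lt F hF := by
    obtain ⟨I, hI⟩ := M.exists_isBasis F.1 F.2.subset_ground
    obtain ⟨e, he⟩ : I.Nonempty := by
      rw [Set.nonempty_iff_ne_empty]
      rintro rfl
      exact hF (by simp [Matroid.natRk, ← hI.eRk_eq_eRk])
    have hlt : M.closure (I \ {e}) ⊂ F.1 := by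
      rw [← F.2.closure, ← hI.closure_eq_closure]
      exact hI.indep.closure_sdiff_singleton_ssubset he
    refine ⟨⟨_, M.isFlat_closure _⟩, hlt, ?_⟩
    rw [← ENat.natCast_le_natCast, Nat.cast_add_one, coe_natRk, coe_natRk, M.eRk_closure_eq,
      ← hI.eRk_eq_eRk]
    calc M.eRk I = M.eRk (insert e (I \ {e})) := by rw [Set.insert_sdiff_self_of_mem he]
      _ ≤ M.eRk (I \ {e}) + 1 := M.eRk_insert_le_add_one e _

lemma isFlat_contract_sdiff (hK : M.IsFlat K) (hFK : F ⊆ K) : (M ／ F).IsFlat (K \ F) := by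
  rw [Matroid.isFlat_iff_closure_eq, Matroid.contract_closure_eq, Set.sdiff_union_of_subset hFK,
    hK.closure]

lemma isFlat_union_of_contract (hF : M.IsFlat F) (hK : (M ／ F).IsFlat K) : M.IsFlat (K ∪ F) := by
  have hground : K ∪ F ⊆ M.E :=
    Set.union_subset (hK.subset_ground.trans Set.sdiff_subset) hF.subset_ground
  have hclosure : M.closure (K ∪ F) \ F = K := by
    rw [← M.contract_closure_eq, hK.closure]
  rw [Matroid.isFlat_iff_closure_eq]
  conv_rhs => rw [← hclosure]
  rw [Set.sdiff_union_of_subset (Set.subset_union_right.trans (M.subset_closure _ hground))]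

/-- The flats of the contraction by a flat `F`, as the flats above `F`. -/
def iciFlatsOrderIso (F : {F : Set α // M.IsFlat F}) :
    Set.Ici F ≃o {K : Set α // (M ／ F.1).IsFlat K} where
  toFun K := ⟨K.1.1 \ F.1, isFlat_contract_sdiff K.1.2 K.2⟩
  invFun K := ⟨⟨K.1 ∪ F.1, isFlat_union_of_contract F.2 K.2⟩, Set.subset_union_right⟩
  left_inv K := Subtype.ext (Subtype.ext (Set.sdiff_union_of_subset K.2))
  right_inv K := by
    have h : Disjoint K.1 F.1 := (Set.subset_sdiff.1 K.2.subset_ground).2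
    exact Subtype.ext (by simpa using h.sdiff_eq_left)
  map_rel_iff' {K K'} := by
    refine ⟨fun h ↦ ?_, fun h ↦ Set.sdiff_subset_sdiff_left h⟩
    change K.1.1 ⊆ K'.1.1
    rw [← Set.sdiff_union_of_subset K.2, ← Set.sdiff_union_of_subset K'.2]
    exact Set.union_subset_union_left _ h

end Flats

/-! ### Dowling lattices through partial `G`-maps -/

/-- A zero-preserving equivariant map from the free pointed right `G`-set on `A` to the one on `B`.
It is given by the images of the generators, `none` standing for zero and `some (b, g)` for the
element `b * g`. The classes of partial `G`-partitions of `[n]` with `k` blocks are the epimorphisms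
from `[n]` to `[k]` up to automorphisms of the target. -/
abbrev PartialGMap (A B G : Type*) := A → Option (B × G)

namespace PartialGMap

variable {A B C G : Type*} [Group G]

/-- The right action of `G` on the free pointed `G`-set on `B`. -/
def shift (g : G) (v : Option (B × G)) : Option (B × G) := v.map fun w ↦ (w.1, w.2 * g)

/-- The composition of equivariant maps. -/
def comp (φ : PartialGMap A B G) (ψ : PartialGMap B C G) : PartialGMap A C G :=
  fun a ↦ (φ a).bind fun v ↦ shift v.2 (ψ v.1)

/-- A choice `r` of generators of the source that `φ` maps to the generators of the target. -/
def IsSection (r : B → A) (φ : PartialGMap A B G) : Prop := ∀ b, φ (r b) = some (b, 1)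

variable {φ : PartialGMap A B G} {ψ : PartialGMap B C G} {r : B → A} {g h : G}
  {v w : Option (B × G)}

@[simp] lemma shift_none : shift g (none : Option (B × G)) = none := rfl

@[simp] lemma shift_some (b : B) (x : G) : shift g (some (b, x)) = some (b, x * g) := rfl

@[simp] lemma shift_eq_none : shift g v = none ↔ v = none := Option.map_eq_none_iff

@[simp] lemma none_eq_shift : none = shift g v ↔ v = none := by rw [eq_comm, shift_eq_none]

@[simp] lemma shift_one : shift 1 v = v := by
  rcases v with _ | ⟨b, x⟩ <;> simp

@[simp] lemma shift_shift : shift h (shift g v) = shift (g * h) v := by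
  rcases v with _ | ⟨b, x⟩ <;> simp [mul_assoc]

lemma shift_eq_iff : shift g v = w ↔ v = shift g⁻¹ w := by
  constructor <;> rintro rfl <;> simp

lemma IsSection.eq_shift (h : IsSection r φ) (b : B) (x : G) :
    some (b, x) = shift x (φ (r b)) := by
  simp [h b]

lemma comp_section (h : IsSection r φ) (ψ : PartialGMap B C G) (b : B) :
    comp φ ψ (r b) = ψ b := by
  simp [comp, h b]

end PartialGMap

namespace PartialGPartition

open PartialGMap

variable {n : ℕ} {B G : Type*}

/-- The partial `G`-partition whose blocks are the fibers of a partial `G`-map. -/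
def ofMap (φ : PartialGMap (Fin n) B G) : PartialGPartition n G where
  carrier := {i | (φ i).isSome}
  label i := ((φ i).get i.2).2
  blocks := Setoid.ker fun i ↦ ((φ i.1).get i.2).1

variable {φ : PartialGMap (Fin n) B G} {i j : Fin n} {g : G}

lemma notMem_ofMap : i ∉ (ofMap φ).carrier ↔ φ i = none := by
  simp [ofMap]

variable [Group G]

lemma ofMap_edge : (ofMap φ).Edge i j g ↔ φ j = shift g (φ i) := by
  by_cases hi : φ i = none
  · have hi' := notMem_ofMap.2 hi
    rw [hi, shift_none, ← notMem_ofMap]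
    exact ⟨fun h ↦ h.notMem hi', edge_of_notMem hi'⟩
  by_cases hj : φ j = none
  · rw [hj, none_eq_shift, iff_false_right hi]
    exact fun h ↦ hi (notMem_ofMap.1 (h.symm.notMem (notMem_ofMap.2 hj)))
  obtain ⟨⟨b, x⟩, hb⟩ := Option.ne_none_iff_exists'.1 hi
  obtain ⟨⟨c, y⟩, hc⟩ := Option.ne_none_iff_exists'.1 hj
  have hi' : i ∈ (ofMap φ).carrier := by simp [ofMap, hb]
  have hj' : j ∈ (ofMap φ).carrier := by simp [ofMap, hc]
  have hblocks : (ofMap φ).blocks ⟨i, hi'⟩ ⟨j, hj'⟩ ↔ b = c := by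
    change ((φ i).get hi').1 = ((φ j).get hj').1 ↔ b = c
    simp only [hb, hc, Option.get_some]
  rw [hb, hc, shift_some, Option.some.injEq, Prod.mk.injEq, eq_comm (a := c), eq_comm (a := y),
    ← hblocks]
  simp [Edge, Rel, ofMap, hb, hc]

open Classical in
/-- The partial `G`-map with the given labels that sends a letter to its block. -/
noncomputable def toMap (p : PartialGPartition n G) :
    PartialGMap (Fin n) (Quotient p.blocks) G :=
  fun i ↦ if hi : i ∈ p.carrier then some (⟦⟨i, hi⟩⟧, p.label ⟨i, hi⟩) else none

lemma edge_iff_toMap {p : PartialGPartition n G} :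
    p.Edge i j g ↔ p.toMap j = shift g (p.toMap i) := by
  by_cases hi : i ∈ p.carrier <;> by_cases hj : j ∈ p.carrier
  · simp [Edge, Rel, toMap, hi, hj, Quotient.eq, p.blocks.comm' (x := ⟨i, hi⟩),
      eq_comm (b := p.label ⟨j, hj⟩)]
  all_goals simp [Edge, toMap, hi, hj]

lemma numBlocks_ofMap {k : ℕ} {φ : PartialGMap (Fin n) (Fin k) G} {r : Fin k → Fin n}
    (h : IsSection r φ) : (ofMap φ).numBlocks = k := by
  have hmem (b : Fin k) : r b ∈ (ofMap φ).carrier := by simp [ofMap, h b]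
  exact (Nat.card_congr (Setoid.quotientKerEquivOfRightInverse _ (fun b ↦ ⟨r b, hmem b⟩)
    fun b ↦ by simp [h b])).trans (Nat.card_fin k)

end PartialGPartition

namespace DowlingLattice

open PartialGPartition PartialGMap

variable {n k : ℕ} {B B' C C' G : Type*} [Group G]

/-- The class of the partial `G`-partition given by a partial `G`-map. -/
def ofMap (φ : PartialGMap (Fin n) B G) : DowlingLattice n G := mk (.ofMap φ)

variable {φ : PartialGMap (Fin n) B G} {φ' : PartialGMap (Fin n) B' G}

lemma ofMap_le_ofMap : ofMap φ ≤ ofMap φ' ↔ (∀ i, φ i = none → φ' i = none) ∧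
    ∀ i j g, φ j = shift g (φ i) → φ' j = shift g (φ' i) := by
  rw [ofMap, ofMap, mk_le_mk, Le]
  simp only [notMem_ofMap, ofMap_edge]

lemma ofMap_eq_ofMap : ofMap φ = ofMap φ' ↔ (∀ i, φ i = none ↔ φ' i = none) ∧
    ∀ i j g, φ j = shift g (φ i) ↔ φ' j = shift g (φ' i) := by
  rw [le_antisymm_iff, ofMap_le_ofMap, ofMap_le_ofMap]
  simp only [iff_def, forall_and]
  tauto

lemma numBlocks_ofMap {φ : PartialGMap (Fin n) (Fin k) G} {r : Fin k → Fin n}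
    (h : IsSection r φ) : (ofMap φ).numBlocks = k :=
  PartialGPartition.numBlocks_ofMap h

lemma ofMap_comp_of_injective {e : B → C} (he : Function.Injective e) (u : B → G) :
    ofMap (comp φ fun b ↦ some (e b, u b)) = ofMap φ := by
  refine ofMap_eq_ofMap.2 ⟨fun i ↦ by cases h : φ i <;> simp [comp, h],
    fun i j g ↦ ?_⟩
  rcases hi : φ i with _ | ⟨b, x⟩ <;> rcases hj : φ j with _ | ⟨c, y⟩ <;>
    simp only [comp, hi, hj, Option.bind_none, Option.bind_some, shift_none, shift_some,
      reduceCtorEq, Option.some.injEq, Prod.mk.injEq, he.eq_iff]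
  refine and_congr_right fun hbc ↦ ?_
  rw [hbc, mul_assoc, mul_right_inj]

lemma mk_eq_ofMap (p : PartialGPartition n G) : mk p = ofMap p.toMap := by
  have hmem (i) : i ∉ p.carrier ↔ i ∉ (PartialGPartition.ofMap p.toMap).carrier := by
    simp [notMem_ofMap, PartialGPartition.toMap]
  have hedge (i j g) : p.Edge i j g ↔ (PartialGPartition.ofMap p.toMap).Edge i j g := by
    rw [ofMap_edge, p.edge_iff_toMap]
  exact le_antisymm (mk_le_mk.2 ⟨fun i ↦ (hmem i).1, fun i j g ↦ (hedge i j g).1⟩)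
    (mk_le_mk.2 ⟨fun i ↦ (hmem i).2, fun i j g ↦ (hedge i j g).2⟩)

lemma exists_ofMap (x : DowlingLattice n G) :
    ∃ (φ : PartialGMap (Fin n) (Fin x.numBlocks) G) (r : Fin x.numBlocks → Fin n),
      IsSection r φ ∧ ofMap φ = x := by
  obtain ⟨p, rfl⟩ := mk_surj x
  let e : Quotient p.blocks ≃ Fin (mk p).numBlocks := Finite.equivFin _
  refine ⟨comp p.toMap fun c ↦ some (e c, (p.label c.out)⁻¹), fun b ↦ (e.symm b).out.1,
    fun b ↦ ?_, (ofMap_comp_of_injective e.injective _).trans (mk_eq_ofMap p).symm⟩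
  simp [comp, PartialGPartition.toMap]

/-- A partial `G`-map that presents `x`, see `exists_isSection_toMap`. -/
noncomputable def toMap (x : DowlingLattice n G) : PartialGMap (Fin n) (Fin x.numBlocks) G :=
  x.exists_ofMap.choose

lemma exists_isSection_toMap (x : DowlingLattice n G) : ∃ r, IsSection r x.toMap :=
  x.exists_ofMap.choose_spec.imp fun _ h ↦ h.1

lemma ofMap_toMap (x : DowlingLattice n G) : ofMap x.toMap = x :=
  x.exists_ofMap.choose_spec.choose_spec.2

lemma ofMap_comp_le_ofMap_comp (ψ : PartialGMap (Fin k) (Fin n) G) (h : ofMap φ ≤ ofMap φ') :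
    ofMap (comp ψ φ) ≤ ofMap (comp ψ φ') := by
  rw [ofMap_le_ofMap] at h ⊢
  refine ⟨fun i hi ↦ ?_, fun i j g hij ↦ ?_⟩
  · rcases hj : ψ i with _ | ⟨b, x⟩ <;>
      simp_all [comp]
  · rcases hi : ψ i with _ | ⟨b, x⟩ <;> rcases hj : ψ j with _ | ⟨c, y⟩ <;>
      simp only [comp, hi, hj, Option.bind_none, Option.bind_some, shift_none, shift_shift,
        none_eq_shift, shift_eq_iff] at hij ⊢
    exacts [h.1 _ hij, h.1 _ hij, h.2 _ _ _ hij]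

lemma ofMap_le_ofMap_comp (φ : PartialGMap (Fin n) B G) (ψ : PartialGMap B C G) :
    ofMap φ ≤ ofMap (comp φ ψ) := by
  refine ofMap_le_ofMap.2 ⟨fun i hi ↦ by simp [comp, hi], fun i j g hij ↦ ?_⟩
  rcases hi : φ i with _ | ⟨b, x⟩ <;> simp [comp, hij, hi]

/-- The precomposition with a partial `G`-map. -/
noncomputable def comap (ψ : PartialGMap (Fin k) (Fin n) G) :
    DowlingLattice n G →o DowlingLattice k G where
  toFun x := ofMap (comp ψ x.toMap)
  monotone' x y hxy := ofMap_comp_le_ofMap_comp ψ (by rwa [ofMap_toMap, ofMap_toMap])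

lemma comap_ofMap (ψ : PartialGMap (Fin k) (Fin n) G) (φ : PartialGMap (Fin n) B G) :
    comap ψ (ofMap φ) = ofMap (comp ψ φ) :=
  (ofMap_comp_le_ofMap_comp ψ (ofMap_toMap _).le).antisymm
    (ofMap_comp_le_ofMap_comp ψ (ofMap_toMap _).ge)

/-- The restriction to a family of letters. -/
noncomputable def restrict (r : Fin k → Fin n) : DowlingLattice n G →o DowlingLattice k G :=
  comap fun b ↦ some (r b, 1)

lemma restrict_ofMap (r : Fin k → Fin n) (φ : PartialGMap (Fin n) B G) :
    restrict r (ofMap φ) = ofMap (φ ∘ r) := by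
  rw [restrict, comap_ofMap]
  exact congrArg ofMap (funext fun b ↦ by simp [comp])

lemma restrict_comap {φ : PartialGMap (Fin n) (Fin k) G} {r : Fin k → Fin n} (h : IsSection r φ)
    (y : DowlingLattice k G) : restrict r (comap φ y) = y := by
  rw [← ofMap_toMap y, comap_ofMap, restrict_ofMap]
  exact congrArg ofMap (funext (comp_section h _))

lemma comap_restrict {φ : PartialGMap (Fin n) (Fin k) G} {r : Fin k → Fin n} (h : IsSection r φ)
    {y : DowlingLattice n G} (hy : ofMap φ ≤ y) : comap φ (restrict r y) = y := by
  rw [← ofMap_toMap y] at hy ⊢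
  rw [restrict_ofMap, comap_ofMap]
  congr 1
  funext i
  rcases hi : φ i with _ | ⟨b, x⟩
  · simp [comp, hi, (ofMap_le_ofMap.1 hy).1 i hi]
  · simpa [comp, hi] using ((ofMap_le_ofMap.1 hy).2 (r b) i x (hi.trans (h.eq_shift b x))).symm

/-- The elements above `x` are the classes of the maps that factor through a map for `x`. -/
theorem nonempty_orderIso_ici (x : DowlingLattice n G) :
    Nonempty (DowlingLattice x.numBlocks G ≃o Set.Ici x) := by
  obtain ⟨r, hr⟩ := x.exists_isSection_toMap
  have hx (y : DowlingLattice x.numBlocks G) : x ≤ comap x.toMap y := by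
    rw [← ofMap_toMap y, comap_ofMap]
    exact (ofMap_toMap x).ge.trans (ofMap_le_ofMap_comp _ _)
  let e : DowlingLattice x.numBlocks G ≃ Set.Ici x :=
    { toFun := fun y ↦ ⟨comap x.toMap y, hx y⟩
      invFun := fun y ↦ restrict r y.1
      left_inv := restrict_comap hr
      right_inv := fun y ↦ Subtype.ext (comap_restrict hr ((ofMap_toMap x).le.trans y.2)) }
  exact ⟨e.toOrderIso (fun _ _ h ↦ (comap _).monotone h) fun _ _ h ↦ (restrict r).monotone h⟩

lemma rank_strictMono : StrictMono (rank : DowlingLattice n G → ℕ) := fun x y hxy ↦ by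
  by_contra h
  exact hxy.ne (eq_of_rank_le hxy.le (not_lt.1 h))

lemma isRankFunction_rank [Finite G] : IsRankFunction (rank : DowlingLattice n G → ℕ) where
  strictMono := rank_strictMono
  exists_lt x hx := by
    have hbot : x ≠ ⊥ := by
      rintro rfl
      exact hx rank_bot
    obtain ⟨y, hy⟩ := exists_covBy_of_wellFoundedGT (not_isMin_iff_ne_bot.2 hbot)
    obtain ⟨a, ha, hax, hay⟩ : ∃ a, IsAtom a ∧ a ≤ x ∧ ¬ a ≤ y := by
      by_contra! h
      exact hy.lt.not_ge (le_of_forall_atom h)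
    obtain ⟨z, hz, hrank⟩ := exists_join y ha
    have hzx : z = x := (hy.eq_or_eq ((hz z).1 le_rfl).1 ((hz x).2 ⟨hy.le, hax⟩)).resolve_left
      fun h ↦ hay (h ▸ (hz z).1 le_rfl).2
    exact ⟨y, hy.lt, hzx ▸ hrank⟩

instance : OrderTop (DowlingLattice n G) where
  top := ofMap fun _ ↦ (none : Option (Fin 0 × G))
  le_top x := by
    rw [← ofMap_toMap x]
    exact ofMap_le_ofMap.2 (by simp)

lemma numBlocks_top : (⊤ : DowlingLattice n G).numBlocks = 0 :=
  numBlocks_ofMap (r := Fin.elim0) (Fin.elim0 ·)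

lemma rank_top : (⊤ : DowlingLattice n G).rank = n := by
  rw [rank, numBlocks_top, Nat.sub_zero]

end DowlingLattice

/-! ### Counting by numbers of blocks -/

namespace PartialGMap

section snoc

variable {n : ℕ} {B G : Type*} {v : Option (B × G)}

/-- The extension of a partial `G`-map to one more letter, with a given value. -/
def snoc (φ : PartialGMap (Fin n) B G) (v : Option (B × G)) : PartialGMap (Fin (n + 1)) B G :=
  Fin.snoc (α := fun _ ↦ Option (B × G)) φ v

@[simp] lemma snoc_castSucc (φ : PartialGMap (Fin n) B G) (i : Fin n) :
    snoc φ v i.castSucc = φ i :=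
  Fin.snoc_castSucc (α := fun _ ↦ Option (B × G)) ..

@[simp] lemma snoc_last (φ : PartialGMap (Fin n) B G) : snoc φ v (Fin.last n) = v :=
  Fin.snoc_last (α := fun _ ↦ Option (B × G)) ..

lemma snoc_comp_castSucc (φ : PartialGMap (Fin n) B G) : snoc φ v ∘ Fin.castSucc = φ :=
  funext fun i ↦ snoc_castSucc φ i

lemma snoc_castSucc_self (ψ : PartialGMap (Fin (n + 1)) B G) :
    snoc (ψ ∘ Fin.castSucc) (ψ (Fin.last n)) = ψ :=
  Fin.snoc_init_self (α := fun _ ↦ Option (B × G)) ψ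

end snoc

lemma eq_shift_self {B G : Type*} [Group G] {g : G} {v : Option (B × G)} :
    v = shift g v ↔ v = none ∨ g = 1 := by
  rcases v with _ | ⟨b, x⟩ <;> simp

end PartialGMap

namespace DowlingLattice

open PartialGMap

variable {n : ℕ} {B B' G : Type*} [Group G] {φ : PartialGMap (Fin n) B G}
  {ψ : PartialGMap (Fin n) B' G} {v : Option (B × G)} {w : Option (B' × G)}

lemma ofMap_snoc_eq_iff : ofMap (snoc φ v) = ofMap (snoc ψ w) ↔ ofMap φ = ofMap ψ ∧
    (v = none ↔ w = none) ∧ ∀ i g, v = shift g (φ i) ↔ w = shift g (ψ i) := by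
  simp only [ofMap_eq_ofMap, Fin.forall_fin_succ', snoc_castSucc, snoc_last, forall_and]
  constructor
  · rintro ⟨⟨hnone, hlast⟩, ⟨hshift, -⟩, hcross, -⟩
    exact ⟨⟨hnone, hshift⟩, hlast, hcross⟩
  · rintro ⟨⟨hnone, hshift⟩, hlast, hcross⟩
    refine ⟨⟨hnone, hlast⟩, ⟨hshift, fun i g ↦ ?_⟩, hcross, fun g ↦ ?_⟩
    · rw [eq_comm, shift_eq_iff, eq_comm (a := ψ i), shift_eq_iff, hcross]
    · rw [eq_shift_self, eq_shift_self, hlast]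

/-- The ways to add a letter to `x`: as a block of its own, or by giving it a value in an old block
or outside of the subset. -/
noncomputable def extend (x : DowlingLattice n G) :
    Option (Option (Fin x.numBlocks × G)) → DowlingLattice (n + 1) G
  | none => ofMap (snoc (comp x.toMap fun b ↦ some (b.castSucc, 1)) (some (Fin.last _, 1)))
  | some v => ofMap (snoc x.toMap v)

lemma numBlocks_extend_none (x : DowlingLattice n G) :
    (x.extend none).numBlocks = x.numBlocks + 1 := by
  obtain ⟨r, hr⟩ := x.exists_isSection_toMap
  refine numBlocks_ofMap (r := Fin.snoc (α := fun _ ↦ _) (Fin.castSucc ∘ r) (Fin.last n)) ?_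
  exact Fin.lastCases (by simp) fun b ↦ by simp [comp, hr b]

lemma numBlocks_extend_some (x : DowlingLattice n G) (v : Option (Fin x.numBlocks × G)) :
    (x.extend (some v)).numBlocks = x.numBlocks := by
  obtain ⟨r, hr⟩ := x.exists_isSection_toMap
  exact numBlocks_ofMap (r := Fin.castSucc ∘ r) fun b ↦ (snoc_castSucc _ _).trans (hr b)

lemma restrict_extend (x : DowlingLattice n G) (o : Option (Option (Fin x.numBlocks × G))) :
    restrict Fin.castSucc (x.extend o) = x := by
  rcases o with _ | v
  · rw [extend, restrict_ofMap, snoc_comp_castSucc,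
      ofMap_comp_of_injective (Fin.castSucc_injective _), ofMap_toMap]
  · rw [extend, restrict_ofMap, snoc_comp_castSucc, ofMap_toMap]

lemma extend_injective (x : DowlingLattice n G) : Function.Injective x.extend := by
  obtain ⟨r, hr⟩ := x.exists_isSection_toMap
  have hnew (v : Option (Fin x.numBlocks × G)) : x.extend none ≠ x.extend (some v) := fun h ↦ by
    obtain ⟨-, hnone, hshift⟩ := ofMap_snoc_eq_iff.1 h
    rcases v with _ | ⟨b, g⟩
    · simp at hnone
    · simpa [comp, hr b, Fin.ext_iff, b.2.ne'] using (hshift (r b) g).2 (hr.eq_shift b g)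
  rintro (_ | v) (_ | w) h
  · rfl
  · exact absurd h (hnew w)
  · exact absurd h.symm (hnew v)
  · obtain ⟨-, hnone, hshift⟩ := ofMap_snoc_eq_iff.1 h
    rcases v with _ | ⟨b, g⟩
    · rw [hnone.1 rfl]
    · rw [(hshift (r b) g).1 (hr.eq_shift b g), hr.eq_shift b g]

lemma exists_extend (y : DowlingLattice (n + 1) G) :
    ∃ o, (restrict Fin.castSucc y).extend o = y := by
  rw [← ofMap_toMap y, ← snoc_castSucc_self y.toMap]
  generalize y.toMap ∘ Fin.castSucc = ψ, y.toMap (Fin.last n) = w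
  rw [restrict_ofMap, snoc_comp_castSucc]
  obtain ⟨hnone, hshift⟩ := ofMap_eq_ofMap.1 (ofMap_toMap (ofMap ψ))
  by_cases hw : w = none
  · refine ⟨some none, ofMap_snoc_eq_iff.2 ⟨ofMap_toMap _, by simp [hw], fun i g ↦ ?_⟩⟩
    simp [hw, hnone]
  by_cases h : ∃ i g, w = shift g (ψ i)
  · obtain ⟨i, g, rfl⟩ := h
    refine ⟨some (shift g ((ofMap ψ).toMap i)), ofMap_snoc_eq_iff.2 ⟨ofMap_toMap _, ?_,
      fun j g' ↦ ?_⟩⟩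
    · simp [hnone]
    · rw [shift_eq_iff, shift_shift, hshift, shift_eq_iff, shift_shift]
  · refine ⟨none, ofMap_snoc_eq_iff.2 ⟨?_, by simp [hw], fun i g ↦ ?_⟩⟩
    · rw [ofMap_comp_of_injective (Fin.castSucc_injective _), ofMap_toMap]
    · refine iff_of_false (fun hi ↦ ?_) fun hi ↦ h ⟨i, g, hi⟩
      rcases hv : (ofMap ψ).toMap i with _ | ⟨b, x⟩
      · simp [comp, hv] at hi
      · simp [comp, hv, Fin.ext_iff, b.2.ne'] at hi

lemma bijective_extend : Function.Bijective
    fun y : Σ x : DowlingLattice n G, Option (Option (Fin x.numBlocks × G)) ↦ y.1.extend y.2 := by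
  refine ⟨?_, fun y ↦ ?_⟩
  · rintro ⟨x, o⟩ ⟨x', o'⟩ h
    obtain rfl : x = x' := by
      simpa only [restrict_extend] using congrArg (restrict Fin.castSucc) h
    exact congrArg (Sigma.mk x) (x.extend_injective h)
  · obtain ⟨o, ho⟩ := exists_extend y
    exact ⟨⟨_, o⟩, ho⟩

theorem finsum_succ [Finite G] {A : Type*} [AddCommMonoid A] (n : ℕ) (f : ℕ → A) :
    ∑ᶠ y : DowlingLattice (n + 1) G, f y.numBlocks = ∑ᶠ x : DowlingLattice n G,
      (f (x.numBlocks + 1) + (1 + Nat.card G * x.numBlocks) • f x.numBlocks) := by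
  have := Fintype.ofFinite G
  have := Fintype.ofFinite (DowlingLattice n G)
  rw [← finsum_comp_equiv (Equiv.ofBijective _ bijective_extend), finsum_eq_sum_of_fintype,
    Fintype.sum_sigma, finsum_eq_sum_of_fintype]
  refine Finset.sum_congr rfl fun x _ ↦ ?_
  simp only [Equiv.ofBijective_apply, Fintype.sum_option (α := Option _), numBlocks_extend_none,
    numBlocks_extend_some, Finset.sum_const, Finset.card_univ, Fintype.card_option,
    Fintype.card_prod, Fintype.card_fin, Nat.card_eq_fintype_card]
  rw [mul_comm, add_comm 1]

instance : Unique (DowlingLattice 0 G) where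
  default := ⊤
  uniq x := by
    rw [← ofMap_toMap x]
    exact ofMap_eq_ofMap.2 ⟨(Fin.elim0 ·), (Fin.elim0 ·)⟩

end DowlingLattice

/-- The number of elements with `k` blocks of the Dowling lattice on `n` letters, for a group of
order `m`. These are the Whitney numbers of the second kind, indexed by the corank. -/
def whitney (m : ℕ) : ℕ → ℕ → ℕ
  | 0, 0 => 1
  | 0, _ + 1 => 0
  | n + 1, 0 => whitney m n 0
  | n + 1, k + 1 => (1 + m * (k + 1)) * whitney m n (k + 1) + whitney m n k

lemma whitney_eq_zero_of_lt (m : ℕ) {n k : ℕ} (h : n < k) : whitney m n k = 0 := by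
  induction n generalizing k with
  | zero =>
    obtain ⟨k, rfl⟩ := Nat.exists_eq_succ_of_ne_zero h.ne'
    rfl
  | succ n ih =>
    obtain ⟨k, rfl⟩ := Nat.exists_eq_succ_of_ne_zero (Nat.ne_zero_of_lt h)
    rw [whitney, ih (by omega), ih (by omega), mul_zero]

lemma whitney_self (m n : ℕ) : whitney m n n = 1 := by
  induction n with
  | zero => rfl
  | succ n ih => rw [whitney, whitney_eq_zero_of_lt m n.lt_succ_self, ih, mul_zero]

lemma sum_whitney_succ {A : Type*} [AddCommMonoid A] (m n : ℕ) (f : ℕ → A) :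
    ∑ k ∈ Finset.range (n + 2), whitney m (n + 1) k • f k = ∑ k ∈ Finset.range (n + 1),
      whitney m n k • (f (k + 1) + (1 + m * k) • f k) := by
  let g (k : ℕ) : A := ((1 + m * k) * whitney m n k) • f k
  have hg : g (n + 1) = 0 := by
    simp only [g, whitney_eq_zero_of_lt m n.lt_succ_self, mul_zero, zero_smul]
  calc ∑ k ∈ Finset.range (n + 2), whitney m (n + 1) k • f k
      = ∑ k ∈ Finset.range (n + 1), whitney m n k • f (k + 1) + (∑ k ∈ Finset.range (n + 1),
          g (k + 1) + g 0) := by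
        rw [Finset.sum_range_succ', ← add_assoc, ← Finset.sum_add_distrib]
        simp only [g, whitney, add_smul, mul_zero, add_zero, one_mul, add_comm (whitney .. • _)]
    _ = ∑ k ∈ Finset.range (n + 1), whitney m n k • f (k + 1) +
          ∑ k ∈ Finset.range (n + 1), g k := by
        rw [← Finset.sum_range_succ', Finset.sum_range_succ g, hg, add_zero]
    _ = _ := by
        simp only [g, ← Finset.sum_add_distrib, smul_add, smul_smul, mul_comm (whitney ..)]

theorem DowlingLattice.finsum_eq_sum_whitney {G : Type*} [Group G] [Finite G] {A : Type*}
    [AddCommMonoid A] (n : ℕ) (f : ℕ → A) : ∑ᶠ x : DowlingLattice n G, f x.numBlocks =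
      ∑ k ∈ Finset.range (n + 1), whitney (Nat.card G) n k • f k := by
  induction n generalizing f with
  | zero =>
    rw [finsum_unique, show (default : DowlingLattice 0 G).numBlocks = 0 from numBlocks_top,
      Finset.sum_range_one, whitney, one_smul]
  | succ n ih =>
    rw [sum_whitney_succ, finsum_succ,
      ih fun k ↦ f (k + 1) + (1 + Nat.card G * k) • f k]

/-! ### Kazhdan–Lusztig polynomials of Dowling geometries -/

section DowlingKL

open Polynomial

/-- The polynomial of degree less than `n / 2` whose sum with `R` has the same coefficients in the
degrees `i` and `n - i`. -/
noncomputable def palindromicPart (n : ℕ) (R : ℤ[X]) : ℤ[X] :=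
  ∑ i ∈ Finset.range n with 2 * i < n, C (R.coeff (n - i) - R.coeff i) * X ^ i

lemma coeff_palindromicPart (n : ℕ) (R : ℤ[X]) (i : ℕ) : (palindromicPart n R).coeff i =
    if 2 * i < n then R.coeff (n - i) - R.coeff i else 0 := by
  simp only [palindromicPart, finsetSum_coeff, coeff_C_mul_X_pow, Finset.sum_ite_eq,
    Finset.mem_filter, Finset.mem_range]
  exact if_congr (by omega) rfl rfl

/-- The Kazhdan–Lusztig polynomial of the Dowling geometry of rank `n` of a group of order `m`. -/
noncomputable def dowlingKL (m n : ℕ) : ℤ[X] :=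
  if n = 0 then 1 else
    palindromicPart n (∑ k : Fin n, whitney m n k • (X ^ (n - k) * dowlingKL m k))

/-- The `Z`-polynomial of the Dowling geometry of rank `n` of a group of order `m`. -/
noncomputable def dowlingZ (m n : ℕ) : ℤ[X] :=
  ∑ k ∈ Finset.range (n + 1), whitney m n k • (X ^ (n - k) * dowlingKL m k)

lemma dowlingKL_zero (m : ℕ) : dowlingKL m 0 = 1 := by
  rw [dowlingKL, if_pos rfl]

lemma dowlingKL_of_ne_zero (m : ℕ) {n : ℕ} (hn : n ≠ 0) : dowlingKL m n =
    palindromicPart n (∑ k ∈ Finset.range n, whitney m n k • (X ^ (n - k) * dowlingKL m k)) := by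
  rw [dowlingKL, if_neg hn, Finset.sum_range]

lemma dowlingZ_eq (m n : ℕ) : dowlingZ m n = dowlingKL m n +
    ∑ k ∈ Finset.range n, whitney m n k • (X ^ (n - k) * dowlingKL m k) := by
  rw [dowlingZ, Finset.sum_range_succ, whitney_self, Nat.sub_self, pow_zero, one_mul, one_smul,
    add_comm]

end DowlingKL

/-- The lattice of flats of `M` is isomorphic to the Dowling lattice on `n` letters over `G`. -/
def HasDowlingFlats {α : Type*} (M : Matroid α) (n : ℕ) (G : Type*) [Group G] : Prop :=
  Nonempty (DowlingLattice n G ≃o {F : Set α // M.IsFlat F})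

section HasDowlingFlats

open Polynomial
open scoped Matroid

variable {α G : Type*} [Finite α] [Group G] [Finite G] {M : Matroid α} {n : ℕ}

lemma natRk_orderIso (e : DowlingLattice n G ≃o {F : Set α // M.IsFlat F})
    (x : DowlingLattice n G) : M.natRk (e x).1 = x.rank :=
  congrFun (((isRankFunction_natRk M).comp_orderIso e).unique DowlingLattice.isRankFunction_rank) x

lemma HasDowlingFlats.natRank_eq (h : HasDowlingFlats M n G) : M.natRank = n := by
  obtain ⟨e⟩ := h
  have htop : (e ⊤).1 = M.E := (e ⊤).2.subset_ground.antisymm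
    (e.symm_apply_le.1 le_top : (⟨M.E, M.ground_isFlat⟩ : {F : Set α // M.IsFlat F}) ≤ e ⊤)
  rw [← DowlingLattice.rank_top (n := n) (G := G), ← natRk_orderIso e, htop, Matroid.natRk,
    M.eRk_ground, Matroid.natRank]

lemma natRank_contract_orderIso (e : DowlingLattice n G ≃o {F : Set α // M.IsFlat F})
    (x : DowlingLattice n G) : (M ／ (e x).1).natRank = x.numBlocks := by
  have h := Matroid.natRk_add_natRank_contract (e x).2
  rw [natRk_orderIso, HasDowlingFlats.natRank_eq ⟨e⟩, DowlingLattice.rank] at h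
  have := x.numBlocks_le
  omega

lemma HasDowlingFlats.contract (h : HasDowlingFlats M n G) {F : Set α} (hF : M.IsFlat F) :
    HasDowlingFlats (M ／ F) (M ／ F).natRank G := by
  obtain ⟨e⟩ := h
  obtain ⟨x, hx⟩ := e.surjective ⟨F, hF⟩
  obtain rfl : (e x).1 = F := congrArg Subtype.val hx
  obtain ⟨j⟩ := x.nonempty_orderIso_ici
  let i : Set.Ici x ≃o Set.Ici (e x) :=
    { toFun := fun y ↦ ⟨e y.1, e.monotone y.2⟩
      invFun := fun K ↦ ⟨e.symm K.1, e.le_symm_apply.2 K.2⟩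
      left_inv := fun y ↦ Subtype.ext (e.symm_apply_apply _)
      right_inv := fun K ↦ Subtype.ext (e.apply_symm_apply _)
      map_rel_iff' := e.le_iff_le }
  rw [natRank_contract_orderIso]
  exact ⟨(j.trans i).trans (iciFlatsOrderIso (e x))⟩

lemma HasDowlingFlats.flatSum_eq (h : HasDowlingFlats M n G) (p : ℕ → ℤ[X]) :
    Matroid.flatSum (fun N ↦ p N.natRank) M =
      ∑ k ∈ Finset.range (n + 1), whitney (Nat.card G) n k • (X ^ (n - k) * p k) := by
  obtain ⟨e⟩ := h
  rw [Matroid.flatSum, ← finsum_comp_equiv e.toEquiv,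
    ← DowlingLattice.finsum_eq_sum_whitney n fun k ↦ X ^ (n - k) * p k]
  refine finsum_congr fun x ↦ ?_
  change X ^ M.natRk (e x).1 * p (M ／ (e x).1).natRank = _
  rw [natRk_orderIso, natRank_contract_orderIso, DowlingLattice.rank]

lemma natRank_contract_lt (hM : M.Loopless) {F : Set α} (hF : M.IsFlat F) (h : F.Nonempty) :
    (M ／ F).natRank < M.natRank := by
  have hlt := (isRankFunction_natRk M).strictMono
    (show (⟨∅, Matroid.isFlat_empty hM⟩ : {F : Set α // M.IsFlat F}) < ⟨F, hF⟩ from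
      Set.empty_ssubset.2 h)
  have := Matroid.natRk_add_natRank_contract hF
  dsimp only at hlt
  omega

theorem HasDowlingFlats.klPoly_eq (hM : M.Loopless) (h : HasDowlingFlats M n G) :
    M.klPoly = dowlingKL (Nat.card G) n := by
  induction n using Nat.strong_induction_on generalizing M with
  | _ n ih =>
  have hr := h.natRank_eq
  rcases eq_or_ne n 0 with rfl | hn
  · rw [Matroid.klPoly_of_natRank_eq_zero M hr, dowlingKL_zero]
  have hsum : ∑ᶠ F : {F : Set α // M.IsFlat F ∧ F.Nonempty},
      X ^ M.natRk F.1 * (M ／ F.1).klPoly =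
      ∑ k ∈ Finset.range n, whitney (Nat.card G) n k • (X ^ (n - k) * dowlingKL (Nat.card G) k) :=
    calc _ = ∑ᶠ F : {F : Set α // M.IsFlat F ∧ F.Nonempty},
          X ^ M.natRk F.1 * dowlingKL (Nat.card G) (M ／ F.1).natRank :=
        finsum_congr fun F ↦ by
          rw [ih _ (hr ▸ natRank_contract_lt hM F.2.1 F.2.2) (Matroid.loopless_contract F.2.1)
            (h.contract F.2.1)]
      _ = _ := by
        have hZ := h.flatSum_eq (dowlingKL (Nat.card G))
        rwa [Matroid.flatSum_eq _ hM, hr, ← dowlingZ, dowlingZ_eq, add_right_inj] at hZ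
  rw [Matroid.klPoly_eq M (hr ▸ hn), hsum, hr, dowlingKL_of_ne_zero _ hn, palindromicPart]

theorem HasDowlingFlats.zPoly_eq (h : HasDowlingFlats M n G) :
    M.zPoly = dowlingZ (Nat.card G) n := by
  rw [Matroid.zPoly, dowlingZ, ← h.flatSum_eq, Matroid.flatSum, Matroid.flatSum]
  exact finsum_congr fun F ↦ by
    rw [(h.contract F.2).klPoly_eq (Matroid.loopless_contract F.2)]

end HasDowlingFlats

/-! ### Computation with polynomials in a parameter -/

/-- A polynomial in a parameter `u`, as the list of its coefficients, on which the kernel can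
compute. -/
abbrev ListPoly := List ℤ

namespace ListPoly

open Polynomial

/-- The sum of two polynomials in the parameter. -/
def add : ListPoly → ListPoly → ListPoly
  | [], b => b
  | a, [] => a
  | x :: a, y :: b => (x + y) :: add a b

/-- An integer multiple of a polynomial in the parameter. -/
def smul (c : ℤ) (a : ListPoly) : ListPoly := a.map (c * ·)

/-- The difference of two polynomials in the parameter. -/
def sub (a b : ListPoly) : ListPoly := add a (smul (-1) b)

/-- The product of two polynomials in the parameter. -/
def mul : ListPoly → ListPoly → ListPoly
  | [], _ => []
  | x :: a, b => add (smul x b) (0 :: mul a b)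

/-- A power of a polynomial in the parameter. -/
def pow (a : ListPoly) : ℕ → ListPoly
  | 0 => [1]
  | n + 1 => mul a (pow a n)

/-- The value at the parameter `u`. -/
def eval (u : ℤ) : ListPoly → ℤ
  | [] => 0
  | x :: a => x + u * eval u a

/-- A sufficient condition for positive values at all parameters `0 ≤ u`. -/
def IsPos (a : ListPoly) : Prop := 0 < a.headD 0 ∧ ∀ x ∈ a, 0 ≤ x

instance : DecidablePred IsPos := fun _ ↦ inferInstanceAs (Decidable (_ ∧ _))

variable {u : ℤ}

lemma eval_add (a b : ListPoly) : eval u (add a b) = eval u a + eval u b := by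
  induction a, b using add.induct with
  | case1 | case2 => simp [add, eval]
  | case3 x a y b ih => simp only [add, eval, ih]; ring

lemma eval_smul (c : ℤ) (a : ListPoly) : eval u (smul c a) = c * eval u a := by
  induction a with
  | nil => simp [smul, eval]
  | cons x a ih => calc
      eval u (smul c (x :: a)) = c * x + u * eval u (smul c a) := rfl
      _ = c * eval u (x :: a) := by rw [ih, eval]; ring

lemma eval_sub (a b : ListPoly) : eval u (sub a b) = eval u a - eval u b := by
  rw [sub, eval_add, eval_smul]; ring

lemma eval_mul (a b : ListPoly) : eval u (mul a b) = eval u a * eval u b := by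
  induction a with
  | nil => simp [mul, eval]
  | cons x a ih => simp only [mul, eval_add, eval_smul, eval, ih]; ring

lemma eval_nonneg (hu : 0 ≤ u) {a : ListPoly} (h : ∀ x ∈ a, 0 ≤ x) : 0 ≤ eval u a := by
  induction a with
  | nil => exact le_rfl
  | cons x a ih =>
    rw [List.forall_mem_cons] at h
    exact add_nonneg h.1 (mul_nonneg hu (ih h.2))

lemma IsPos.eval_pos (hu : 0 ≤ u) {a : ListPoly} (h : IsPos a) : 0 < eval u a := by
  obtain ⟨hhead, hmem⟩ := h
  cases a with
  | nil => exact absurd hhead (lt_irrefl _)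
  | cons x a =>
    exact add_pos_of_pos_of_nonneg hhead
      (mul_nonneg hu (eval_nonneg hu (List.forall_mem_cons.1 hmem).2))

/-- The polynomial with the given coefficients, at the parameter `u`. -/
noncomputable def toPolynomial (u : ℤ) : List ListPoly → ℤ[X]
  | [] => 0
  | c :: L => C (eval u c) + X * toPolynomial u L

/-- The sum of two polynomials whose coefficients depend on the parameter. -/
def addPoly : List ListPoly → List ListPoly → List ListPoly
  | [], L => L
  | K, [] => K
  | a :: K, b :: L => add a b :: addPoly K L

/-- Numerator and denominator of the value at `a / b`, by Horner's rule. -/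
def evalDiv (a b : ListPoly) : List ListPoly → ListPoly × ListPoly
  | [] => ([], [1])
  | c :: L =>
    let v := evalDiv a b L
    let q := mul b v.2
    (add (mul q c) (mul a v.1), q)

lemma toPolynomial_addPoly (K L : List ListPoly) :
    toPolynomial u (addPoly K L) = toPolynomial u K + toPolynomial u L := by
  induction K, L using addPoly.induct with
  | case1 | case2 => simp [addPoly, toPolynomial]
  | case3 a K b L ih => simp only [addPoly, toPolynomial, ih, eval_add, C_add]; ring

lemma toPolynomial_map_mul (c : ListPoly) (L : List ListPoly) :
    toPolynomial u (L.map (mul c)) = eval u c • toPolynomial u L := by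
  rw [smul_eq_C_mul]
  induction L with
  | nil => simp [toPolynomial]
  | cons x L ih => simp only [List.map_cons, toPolynomial, ih, eval_mul, C_mul]; ring

lemma toPolynomial_nil_cons (L : List ListPoly) :
    toPolynomial u ([] :: L) = X * toPolynomial u L := by
  simp [toPolynomial, eval]

lemma coeff_toPolynomial (L : List ListPoly) (i : ℕ) :
    (toPolynomial u L).coeff i = eval u (L.getD i []) := by
  induction L generalizing i with
  | nil => simp [toPolynomial, eval]
  | cons c L ih =>
    cases i with
    | zero => simp [toPolynomial]
    | succ i =>
      rw [toPolynomial, coeff_add, coeff_C_succ, coeff_X_mul, zero_add, ih, List.getD_cons_succ]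

lemma natDegree_toPolynomial_le (L : List ListPoly) :
    (toPolynomial u L).natDegree ≤ L.length - 1 := by
  rw [natDegree_le_iff_coeff_eq_zero]
  intro i hi
  rw [coeff_toPolynomial, List.getD_eq_default _ _ (by omega), eval]

lemma eval_evalDiv_snd (a b : ListPoly) (L : List ListPoly) :
    eval u (evalDiv a b L).2 = eval u b ^ L.length := by
  induction L with
  | nil => simp [evalDiv, eval]
  | cons c L ih => simp only [evalDiv, eval_mul, ih, List.length_cons, pow_succ']

lemma eval_evalDiv_fst (a : ListPoly) {b : ListPoly} (hb : eval u b ≠ 0) (L : List ListPoly) :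
    (eval u (evalDiv a b L).1 : ℝ) =
      (eval u b : ℝ) ^ L.length * aeval ((eval u a : ℝ) / eval u b) (toPolynomial u L) := by
  induction L with
  | nil => simp [evalDiv, eval, toPolynomial]
  | cons c L ih =>
    have hb' : (eval u b : ℝ) ≠ 0 := Int.cast_ne_zero.2 hb
    simp only [evalDiv, eval_add, eval_mul, eval_evalDiv_snd, toPolynomial, Int.cast_add,
      Int.cast_mul, Int.cast_pow, ih, map_add, map_mul, aeval_X, eq_intCast, map_intCast,
      List.length_cons, pow_succ]
    field_simp

/-- The signs of the polynomial with coefficients `L` alternate, beginning with a positive one, at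
`d + 1` decreasing points, given by their numerators and denominators, and its degree is at most
`d + 1`. All of this is required with the positivity test `IsPos`. -/
def Alternates (L : List ListPoly) (d : ℕ) (x : ℕ → ListPoly × ListPoly) : Prop :=
  L.length ≤ d + 2 ∧
  (∀ i < d + 1, IsPos (x i).2 ∧ IsPos (smul ((-1) ^ i) (evalDiv (x i).1 (x i).2 L).1)) ∧
  ∀ i < d, IsPos (sub (mul (x i).1 (x (i + 1)).2) (mul (x (i + 1)).1 (x i).2))

instance (L : List ListPoly) (d : ℕ) (x : ℕ → ListPoly × ListPoly) :
    Decidable (Alternates L d x) :=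
  inferInstanceAs (Decidable (_ ∧ _ ∧ _))

theorem Alternates.isRealRooted (hu : 0 ≤ u) {L : List ListPoly} {d : ℕ}
    {x : ℕ → ListPoly × ListPoly} (h : Alternates L d x) : IsRealRooted (toPolynomial u L) := by
  obtain ⟨hlength, hsign, hlt⟩ := h
  have hden (i : Fin (d + 1)) : (0 : ℝ) < eval u (x i).2 :=
    Int.cast_pos.2 ((hsign i i.2).1.eval_pos hu)
  refine isRealRooted_of_alternating (d := d)
    ((natDegree_toPolynomial_le L).trans (by omega))
    (x := fun i ↦ (eval u (x i).1 : ℝ) / eval u (x i).2)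
    (Fin.strictAnti_iff_succ_lt.2 fun i ↦ ?_) fun i ↦ ?_
  · have hcross := (hlt i i.2).eval_pos hu
    rw [eval_sub, eval_mul, eval_mul, sub_pos] at hcross
    rw [div_lt_div_iff₀ (hden _) (hden _)]
    exact_mod_cast hcross
  · have hpos := (hsign i i.2).2.eval_pos hu
    rw [eval_smul, ← Int.cast_pos (R := ℝ), Int.cast_mul,
      eval_evalDiv_fst _ (Int.cast_ne_zero.1 (hden i).ne'), mul_left_comm,
      mul_pos_iff_of_pos_left (pow_pos (hden i) _)] at hpos
    simpa using hpos

end ListPoly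

/-! ### The coefficients for Dowling geometries -/

section Coefficients

open ListPoly
open Polynomial (X)

/-- The next row of Whitney numbers from the `k`-th entry on, where `a` is entry `k - 1` of the row
above, followed by the entries in the list. -/
def whitneyStep : ℕ → ListPoly → List ListPoly → List ListPoly
  | _, a, [] => [a]
  | k, a, b :: L => add (mul [1 + (k : ℤ), k] b) a :: whitneyStep (k + 1) b L

/-- The Whitney numbers `whitney (u + 1) n k` for `k ≤ n`, as polynomials in `u`. Taking `u + 1` for
the order of the group makes the parameter range over all natural numbers. -/
def whitneyRow : ℕ → List ListPoly
  | 0 => [[1]]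
  | n + 1 => whitneyStep 0 [] (whitneyRow n)

/-- The coefficients of `palindromicPart`. -/
def palindromicPartCoeffs (n : ℕ) (R : List ListPoly) : List ListPoly :=
  (List.range ((n + 1) / 2)).map fun i ↦ sub (R.getD (n - i) []) (R.getD i [])

/-- The coefficients of `∑ k < n, W k * X ^ (n - k) * P k`. -/
def convolution (W : List ListPoly) (P : List (List ListPoly)) : ℕ → List ListPoly
  | 0 => []
  | n + 1 => [] :: addPoly (convolution W P n) ((P.getD n []).map (mul (W.getD n [])))

/-- The coefficients of `dowlingKL (u + 1) k` for `k ≤ n`, as polynomials in `u`. -/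
def klTable : ℕ → List (List ListPoly)
  | 0 => [[[1]]]
  | n + 1 => klTable n ++
    [palindromicPartCoeffs (n + 1) (convolution (whitneyRow (n + 1)) (klTable n) (n + 1))]

/-- The coefficients of `dowlingKL (u + 1) n`, as polynomials in `u`. -/
def klCoeffs (n : ℕ) : List ListPoly := (klTable n).getD n []

/-- The coefficients of `dowlingZ (u + 1) n`, as polynomials in `u`. -/
def zCoeffs (n : ℕ) : List ListPoly :=
  addPoly (klCoeffs n) (convolution (whitneyRow n) (klTable n) n)

lemma eval_whitneyStep {u : ℤ} (k : ℕ) (a : ListPoly) (L : List ListPoly) (j : ℕ) :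
    eval u ((whitneyStep k a L).getD j []) =
      (1 + (u + 1) * (k + j)) * eval u (L.getD j []) + eval u ((a :: L).getD j []) := by
  induction L generalizing k a j with
  | nil => cases j <;> simp [whitneyStep, eval]
  | cons b L ih =>
    cases j with
    | zero =>
      simp only [whitneyStep, List.getD_cons_zero, eval_add, eval_mul, eval, Nat.cast_zero]
      ring
    | succ j =>
      rw [whitneyStep, List.getD_cons_succ, ih, List.getD_cons_succ, List.getD_cons_succ]
      push_cast
      ring

variable {u n k : ℕ}

lemma eval_whitneyRow (n k : ℕ) :
    eval u ((whitneyRow n).getD k []) = (whitney (u + 1) n k : ℤ) := by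
  induction n generalizing k with
  | zero => cases k <;> simp [whitneyRow, whitney, eval]
  | succ n ih =>
    rw [whitneyRow, eval_whitneyStep, ih]
    cases k with
    | zero => simp [whitney, eval]
    | succ k => rw [List.getD_cons_succ, ih, whitney]; push_cast; ring

lemma toPolynomial_palindromicPartCoeffs (u : ℤ) (n : ℕ) (R : List ListPoly) :
    toPolynomial u (palindromicPartCoeffs n R) = palindromicPart n (toPolynomial u R) := by
  ext i
  rw [coeff_palindromicPart, coeff_toPolynomial, coeff_toPolynomial, coeff_toPolynomial]
  split_ifs with h
  · rw [palindromicPartCoeffs, List.getD_eq_getElem _ _ (by simp; omega)]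
    simp [eval_sub]
  · rw [palindromicPartCoeffs, List.getD_eq_default _ _ (by simp; omega), eval]

lemma toPolynomial_convolution (u : ℤ) (W : List ListPoly) (P : List (List ListPoly)) (n : ℕ) :
    toPolynomial u (convolution W P n) = ∑ k ∈ Finset.range n,
      eval u (W.getD k []) • (X ^ (n - k) * toPolynomial u (P.getD k [])) := by
  induction n with
  | zero => rfl
  | succ n ih =>
    rw [convolution, toPolynomial_nil_cons, toPolynomial_addPoly, toPolynomial_map_mul, ih,
      Finset.sum_range_succ, mul_add, Finset.mul_sum, Nat.add_sub_cancel_left, pow_one,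
      mul_smul_comm]
    refine congrArg (· + _) (Finset.sum_congr rfl fun k hk ↦ ?_)
    rw [Nat.succ_sub (Finset.mem_range.1 hk).le, pow_succ', mul_smul_comm, mul_assoc]

lemma toPolynomial_convolution_whitneyRow {P : List (List ListPoly)}
    (hP : ∀ k < n, toPolynomial u (P.getD k []) = dowlingKL (u + 1) k) :
    toPolynomial u (convolution (whitneyRow n) P n) = ∑ k ∈ Finset.range n,
      whitney (u + 1) n k • (X ^ (n - k) * dowlingKL (u + 1) k) := by
  rw [toPolynomial_convolution]
  refine Finset.sum_congr rfl fun k hk ↦ ?_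
  rw [eval_whitneyRow, natCast_zsmul, hP k (Finset.mem_range.1 hk)]

lemma length_klTable (n : ℕ) : (klTable n).length = n + 1 := by
  induction n with
  | zero => rfl
  | succ n ih => rw [klTable, List.length_append, ih, List.length_singleton]

lemma toPolynomial_klTable (hk : k ≤ n) :
    toPolynomial u ((klTable n).getD k []) = dowlingKL (u + 1) k := by
  induction n generalizing k with
  | zero =>
    obtain rfl := Nat.le_zero.1 hk
    simp [klTable, toPolynomial, eval, dowlingKL_zero]
  | succ n ih =>
    rcases hk.lt_or_eq with hk | rfl
    · rw [klTable, List.getD_append _ _ _ _ (by rwa [length_klTable]), ih (Nat.lt_succ_iff.1 hk)]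
    · rw [klTable, List.getD_append_right _ _ _ _ (length_klTable n).le, length_klTable,
        Nat.sub_self, List.getD_cons_zero, toPolynomial_palindromicPartCoeffs,
        toPolynomial_convolution_whitneyRow fun k hk ↦ ih (Nat.lt_succ_iff.1 hk),
        dowlingKL_of_ne_zero _ n.succ_ne_zero]

theorem toPolynomial_klCoeffs (u n : ℕ) : toPolynomial u (klCoeffs n) = dowlingKL (u + 1) n :=
  toPolynomial_klTable le_rfl

theorem toPolynomial_zCoeffs (u n : ℕ) : toPolynomial u (zCoeffs n) = dowlingZ (u + 1) n := by
  rw [zCoeffs, toPolynomial_addPoly, toPolynomial_klCoeffs, dowlingZ_eq,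
    toPolynomial_convolution_whitneyRow fun k hk ↦ toPolynomial_klTable hk.le]

end Coefficients

/-! ### Separating the roots -/

section Separators

open ListPoly

/-- The negatives of the inverses of points between consecutive roots, up to a constant factor, as
polynomials in the order of the group minus one. The root closest to zero tends to zero as the
order grows, and a power of the order in the first entry accounts for this. -/
def separators (n : ℕ) : List ℕ → List ListPoly
  | [] => []
  | e :: E => smul (2 ^ e) (pow [1, 1] (n / 5)) :: E.map fun e ↦ [2 ^ e]

/-- The base two logarithms of the numbers of `separators` for the Kazhdan--Lusztig polynomial of
rank `n`, at the `n`-th entry, up to a power of the order of the group. They were found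
numerically. -/
def klExponents : List (List ℕ) :=
  [[], [], [], [], [], [4], [6], [8, 5], [10, 7], [11, 8, 4], [11, 9, 5], [12, 10, 7, 3],
    [14, 11, 8, 4], [15, 12, 8, 6, 2], [16, 13, 9, 6, 4], [16, 14, 10, 7, 5, 1]]

/-- The same as `klExponents`, for the part in `(-1, 0)` of the roots of the `Z`-polynomial. -/
def zExponents : List (List ℕ) :=
  [[], [], [0], [1], [3, 0], [3, 1], [4, 2, 0], [5, 3, 1], [7, 4, 2, 0], [8, 5, 3, 1],
    [8, 6, 3, 1, 0], [9, 7, 4, 2, 1], [11, 8, 5, 3, 1, 0], [12, 9, 6, 3, 2, 1],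
    [13, 10, 6, 4, 2, 1, 0], [13, 11, 7, 5, 3, 2, 1]]

/-- Numerators and denominators of decreasing points that separate the roots of the
Kazhdan--Lusztig polynomial of rank `n`. -/
def klPoint (n : ℕ) : ℕ → ListPoly × ListPoly
  | 0 => ([], [1])
  | i + 1 => ([-8], (separators n (klExponents.getD n [])).getD i [])

/-- Numerators and denominators of decreasing points that separate the roots of the `Z`-polynomial
of rank `n`. They are symmetric under `t ↦ 1 / t`, because the `Z`-polynomial is palindromic. -/
def zPoint (n : ℕ) : ℕ → ListPoly × ListPoly
  | 0 => ([], [1])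
  | i + 1 =>
    let S := separators n (zExponents.getD n [])
    if i < n / 2 then ([-1], S.getD i []) else (smul (-1) (S.getD (n - 2 - i) []), [1])

set_option maxRecDepth 100000 in
lemma alternates_coeffs : ∀ n < 16, Alternates (klCoeffs n) ((n - 1) / 2 - 1) (klPoint n) ∧
    Alternates (zCoeffs n) (n - 1) (zPoint n) := by
  decide +kernel

end Separators

theorem proposition5p2_general {α G : Type*} [Finite α] [Group G] [Finite G] {M : Matroid α}
    {n : ℕ} (hM : M.Loopless) (h : HasDowlingFlats M n G) (hn : n ≤ 15) :
    IsRealRooted M.klPoly ∧ IsRealRooted M.zPoly := by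
  obtain ⟨u, hu⟩ : ∃ u : ℕ, Nat.card G = u + 1 := Nat.exists_eq_succ_of_ne_zero Nat.card_pos.ne'
  obtain ⟨hkl, hz⟩ := alternates_coeffs n (Nat.lt_succ_of_le hn)
  rw [h.klPoly_eq hM, h.zPoly_eq, hu, ← toPolynomial_klCoeffs, ← toPolynomial_zCoeffs]
  exact ⟨hkl.isRealRooted (Int.natCast_nonneg u), hz.isRealRooted (Int.natCast_nonneg u)⟩

theorem proposition5p2 (n : ℕ) (hn : n ≤ 15) (G : Type*) [Group G] [Finite G] :
    IsRealRooted (dowlingGeometry n G).klPoly ∧ IsRealRooted (dowlingGeometry n G).zPoly :=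
  have ⟨e, _⟩ := dowlingGeometry_flats (n := n) (G := G)
  proposition5p2_general dowlingGeometry_loopless ⟨e⟩ hn
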